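/- Let $\nu>e$, let $W$ be a two-sided standard Brownian motion, and let $\psi\in L^2(\mathbb{R})$ be real-valued with $\|\psi\|_2\neq 0$. For $(t,h)\in\mathcal{T}:=[0,1]\times(0,1]$ put $\psi_{t,h}:=\psi\big(\tfrac{\cdot-t}{h}\big)$ (so that $\|\psi_{t,h}\|_2=\sqrt h\,\|\psi\|_2$) and $$w_h:=\frac{\sqrt{\tfrac12\log\tfrac{\nu}{h}}}{\log\log\tfrac{\nu}{h}},$$ and let $\int\psi_{t,h}(s)\,dW_s$ denote the Wiener integral (any version of it, for each $(t,h)$). Assume that $$\lim_{j\to\infty,\ j\in\mathbb{N}}\log(j)\,\Big|\int\psi(s-j)\psi(s)\,ds\Big|=0 .$$ Let $(K_n)_{n}$ be a sequence of natural numbers with $K_n\to\infty$, and let $B^\circ_{K_n}:=\{(\tfrac{i}{K_n},\tfrac1{K_n}) : i=0,\ldots,K_n-1\}$. Then, as $n\to\infty$, $$\sup_{(t,h)\in B^\circ_{K_n}} w_h\left(\frac{\big|\int\psi_{t,h}(s)\,dW_s\big|}{\|\psi_{t,h}\|_2}-\sqrt{2\log\tfrac{\nu}{h}}\right)\longrightarrow-\frac14\quad\text{in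 probability.}$$ Consequently, for all sets $B_n\subset\mathcal{T}$ with $B^\circ_{K_n}\subset B_n$ for every $n$, the approximating statistic over $B_n$ is asymptotically bounded from below by $-\tfrac14$: for every $\varepsilon>0$, $$\mathbb{P}\left(\sup_{(t,h)\in B_n} w_h\left(\frac{\big|\int\psi_{t,h}(s)\,dW_s\big|}{\|\psi_{t,h}\|_2}-\sqrt{2\log\tfrac{\nu}{h}}\right)\leq-\frac14-\varepsilon\right)\longrightarrow0,$$ where the supremum takes values in $[-\infty,\infty]$ and $\mathbb{P}$ is read as outer probability if the event is not measurable. -/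

import Mathlib

open MeasureTheory ProbabilityTheory Filter Topology
open scoped NNReal ENNReal

noncomputable section

namespace Multiscale

/-- A two-sided standard Brownian motion on `ℝ`: the two halves `(W t)_{t ≥ 0}` and
`(W (-t))_{t ≥ 0}` are independent standard Brownian motions. -/
structure IsTwoSidedBrownian {Ω : Type*} [MeasurableSpace Ω] (W : ℝ → Ω → ℝ) (P : Measure Ω) :
    Prop where
  pos : IsBrownianReal (fun t : ℝ≥0 => W (t : ℝ)) P
  neg : IsBrownianReal (fun t : ℝ≥0 => W (-(t : ℝ))) P
  indep : IndepFun (fun ω (t : ℝ≥0) => W (t : ℝ) ω) (fun ω (t : ℝ≥0) => W (-(t : ℝ)) ω) P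

/-- A step function `∑ i, c i • 1_{(a i, b i]}` with `a i ≤ b i`. -/
structure StepFun where
  size : ℕ
  a : Fin size → ℝ
  b : Fin size → ℝ
  a_le_b : ∀ i, a i ≤ b i
  c : Fin size → ℝ

/-- The function `ℝ → ℝ` that a step function describes. -/
def StepFun.toFun (s : StepFun) (x : ℝ) : ℝ :=
  ∑ i, Set.indicator (Set.Ioc (s.a i) (s.b i)) (fun _ => s.c i) x

/-- The stochastic integral `∑ i, c i * (W (b i) - W (a i))` of a step function. -/
def StepFun.integral {Ω : Type*} (s : StepFun) (W : ℝ → Ω → ℝ) (ω : Ω) : ℝ :=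
  ∑ i, s.c i * (W (s.b i) ω - W (s.a i) ω)

/-- `I` is a version of the Wiener integral `∫ φ dW`: for some step functions that converge to `φ`
in `L²(ℝ)`, the integrals of the step functions converge to `I` in `L²(P)`. -/
def IsWienerIntegral {Ω : Type*} [MeasurableSpace Ω] (P : Measure Ω) (W : ℝ → Ω → ℝ)
    (φ : ℝ → ℝ) (I : Ω → ℝ) : Prop :=
  MemLp I 2 P ∧ ∃ s : ℕ → StepFun,
    Tendsto (fun m => eLpNorm (fun x => φ x - (s m).toFun x) 2 volume) atTop (𝓝 0) ∧
    Tendsto (fun m => eLpNorm (fun ω => I ω - (s m).integral W ω) 2 P) atTop (𝓝 0)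

open Classical in
/-- The Wiener integral `∫ φ dW` (a version of it, which is unique up to almost sure equality;
it exists for every `φ ∈ L²(ℝ)` when `W` is a two-sided standard Brownian motion). -/
def wienerIntegral {Ω : Type*} [MeasurableSpace Ω] (P : Measure Ω) (W : ℝ → Ω → ℝ)
    (φ : ℝ → ℝ) : Ω → ℝ :=
  if h : ∃ I : Ω → ℝ, IsWienerIntegral P W φ I then h.choose else 0

/-- The index set `𝒯 = [0,1] × (0,1]` of pairs `(t, h)`. -/
def indexSet : Set (ℝ × ℝ) := Set.Icc 0 1 ×ˢ Set.Ioc 0 1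

/-- The single-scale grid `B°_K = {(i / K, 1 / K) | i = 0, …, K - 1}`. -/
def grid (K : ℕ) : Set (ℝ × ℝ) := {p | ∃ i : ℕ, i < K ∧ p = ((i : ℝ) / K, 1 / (K : ℝ))}

/-- `ψ_{t,h} = ψ((· - t) / h)` for `p = (t, h)`. -/
def kernel (ψ : ℝ → ℝ) (p : ℝ × ℝ) (s : ℝ) : ℝ := ψ ((s - p.1) / p.2)

/-- The weight `w_h = √(½ log(ν/h)) / log log(ν/h)`. -/
def weight (ν h : ℝ) : ℝ := √(1 / 2 * Real.log (ν / h)) / Real.log (Real.log (ν / h))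

/-- The calibrated local statistic `w_h (|x| / ‖ψ_{t,h}‖₂ - √(2 log(ν/h)))` for `p = (t, h)`,
where `x` is the value of `∫ ψ_{t,h} dW`. -/
def localStat (ν : ℝ) (ψ : ℝ → ℝ) (p : ℝ × ℝ) (x : ℝ) : ℝ :=
  weight ν p.2 * (|x| / lpNorm (kernel ψ p) 2 volume - √(2 * Real.log (ν / p.2)))

end Multiscale

end

/-!
The normalized integrals `Z i = ∫ ψ_{i/K, 1/K} dW / ‖ψ_{i/K, 1/K}‖₂`, `i < K`, form a stationary
sequence of standard Gaussian variables whose correlation at lag `j` is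
`r j = ∫ ψ(s - j) ψ(s) ds / ‖ψ‖₂²`. With `L = log (ν K)`, the calibrated statistic of `Z i` is at
least `c` exactly when `|Z i|` is at least the level `u` given by `threshold c L`, and
`u² / 2 = L + 2 c log L + o(1)`. Since `P(|Z i| ≥ u)` is of order `exp(-u² / 2) / u`, the expected
number of exceedances is of order `L ^ (-2 c - 1 / 2)`, which makes `-1/4` the critical value of
`c`.

* For `c > -1/4` a union bound with Mills' inequality (`gaussianReal_abs_ge_le`) shows that there
  are no exceedances in the limit: `tendsto_measure_exists_ge`.
* For `c < -1/4` the second moment method (`measure_forall_notMem_le`) shows that there is one: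
  `tendsto_measure_forall_lt`. It is applied to the events `Z i ∈ [u, v]` with `v = u + 1 / u`.
  Truncation at `v` keeps the order of their probability `p` and makes the ratio of the bivariate
  Gaussian density to the product density at most `exp (|r| (v² + 1))`, so that two events at lag
  `j` occur together with probability at most `p² exp (|r j| (v² + 1))`
  (`IsWienerIntegral.measure_pair_Icc_le`). As `v²` is of order `log K`, the assumption
  `r j log j → 0` makes this factor close to `1` except for lags of smaller order than `K`, where
  it is enough that the correlations are small (`tendsto_average_exp_correlation`). Passing to
  indices `i` in a fixed arithmetic progression makes all correlations small.

The Gaussian input comes from the Wiener integral as the `L²` limit of integrals of step functions.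
The integral of a step function `s` is a centred Gaussian variable with variance `‖s‖₂²`
(`StepFun.hasLaw_integral`), and step functions are dense in `L²(ℝ)`, so that the Wiener integral
exists (`exists_isWienerIntegral`), is linear in the integrand and Gaussian
(`IsWienerIntegral.hasLaw`). Applied to linear combinations, this identifies joint characteristic
functions and yields independence for orthogonal integrands (`IsWienerIntegral.indepFun`).
-/

namespace Multiscale

/-! ### Step functions and their stochastic integrals -/

section PreBrownian

variable {Ω : Type*} [MeasurableSpace Ω] {P : Measure Ω} {B : ℝ≥0 → Ω → ℝ} {n : ℕ}

lemma hasGaussianLaw_sum_increments (hB : IsPreBrownianReal B P) (x y : Fin n → ℝ≥0)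
    (c : Fin n → ℝ) : HasGaussianLaw (fun ω => ∑ i, c i * (B (y i) ω - B (x i) ω)) P := by
  have h : IsGaussianProcess (fun i ω => c i * (B (y i) ω - B (x i) ω)) P := by
    classical
    refine hB.isGaussianProcess.of_isGaussianProcess fun i => ⟨{x i, y i},
      { toFun z := c i * (z ⟨y i, by simp⟩ - z ⟨x i, by simp⟩)
        map_add' z w := by simp; ring
        map_smul' r z := by simp; ring }, fun ω => by simp⟩
  exact h.hasGaussianLaw_fun_sum

lemma integral_sum_increments (hB : IsPreBrownianReal B P) (x y : Fin n → ℝ≥0)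
    (c : Fin n → ℝ) : ∫ ω, ∑ i, c i * (B (y i) ω - B (x i) ω) ∂P = 0 := by
  rw [integral_finsetSum]
  · refine Finset.sum_eq_zero fun i _ => ?_
    rw [integral_const_mul, integral_sub (hB.integrable_eval _) (hB.integrable_eval _),
      hB.integral_eval, hB.integral_eval]
    simp
  · exact fun i _ => ((hB.integrable_eval _).sub (hB.integrable_eval _)).const_mul _

/-- The covariance of two increments is the length of the overlap of the two intervals. -/
lemma covariance_increments (hB : IsPreBrownianReal B P) {a b c d : ℝ≥0} (hab : a ≤ b)
    (hcd : c ≤ d) : cov[fun ω => B b ω - B a ω, fun ω => B d ω - B c ω; P] =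
      max 0 (min (b : ℝ) d - max (a : ℝ) c) := by
  have := hB.isGaussianProcess.isProbabilityMeasure
  have hm := fun t => (hB.isGaussianProcess.hasGaussianLaw_eval t).memLp_two
  rw [covariance_fun_sub_fun_sub (hm _) (hm _) (hm _) (hm _)]
  simp_rw [hB.covariance_fun_eval]
  have h1 : (a : ℝ) ≤ b := hab
  have h2 : (c : ℝ) ≤ d := hcd
  push_cast
  grind

lemma variance_sum_increments (hB : IsPreBrownianReal B P) {x y : Fin n → ℝ≥0}
    (hxy : ∀ i, x i ≤ y i) (c : Fin n → ℝ) :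
    Var[fun ω => ∑ i, c i * (B (y i) ω - B (x i) ω); P] =
      ∑ i, ∑ j, c i * c j * max 0 (min (y i : ℝ) (y j) - max (x i : ℝ) (x j)) := by
  have := hB.isGaussianProcess.isProbabilityMeasure
  have hm := fun t => (hB.isGaussianProcess.hasGaussianLaw_eval t).memLp_two
  rw [variance_fun_sum (X := fun i ω => c i * (B (y i) ω - B (x i) ω)) fun i =>
    ((hm _).sub (hm _)).const_mul _]
  refine Finset.sum_congr rfl fun i _ => Finset.sum_congr rfl fun j _ => ?_
  rw [covariance_const_mul_left, covariance_const_mul_right,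
    covariance_increments hB (hxy i) (hxy j)]
  ring

end PreBrownian

lemma StepFun.toFun_eq (s : StepFun) :
    s.toFun = fun x => ∑ i, Set.indicator (Set.Ioc (s.a i) (s.b i)) (fun _ => s.c i) x := rfl

lemma StepFun.memLp_toFun (s : StepFun) (p : ℝ≥0∞) : MemLp s.toFun p volume := by
  rw [s.toFun_eq]
  refine memLp_finsetSum _ fun i _ => ?_
  exact memLp_indicator_const p measurableSet_Ioc _ (Or.inr (by simp))

lemma StepFun.integral_toFun_sq (s : StepFun) : ∫ x, s.toFun x ^ 2 =
    ∑ i, ∑ j, s.c i * s.c j * max 0 (min (s.b i) (s.b j) - max (s.a i) (s.a j)) := by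
  have h : ∀ x, s.toFun x ^ 2 = ∑ i, ∑ j, Set.indicator
      (Set.Ioc (s.a i ⊔ s.a j) (s.b i ⊓ s.b j)) (fun _ => s.c i * s.c j) x := by
    intro x
    simp only [StepFun.toFun, sq, Finset.sum_mul_sum]
    refine Finset.sum_congr rfl fun i _ => Finset.sum_congr rfl fun j _ => ?_
    rw [← Set.Ioc_inter_Ioc, Set.inter_indicator_mul]
  have hint : ∀ i j, Integrable (Set.indicator
      (Set.Ioc (s.a i ⊔ s.a j) (s.b i ⊓ s.b j)) (fun _ => s.c i * s.c j)) volume := fun i j =>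
    (integrable_indicator_iff measurableSet_Ioc).2 (integrableOn_const (by simp))
  simp_rw [h]
  rw [integral_finsetSum _ fun i _ => integrable_finsetSum _ fun j _ => hint i j]
  refine Finset.sum_congr rfl fun i _ => ?_
  rw [integral_finsetSum _ fun j _ => hint i j]
  refine Finset.sum_congr rfl fun j _ => ?_
  rw [integral_indicator_const _ measurableSet_Ioc]
  simp only [Measure.real, Real.volume_Ioc, smul_eq_mul, ENNReal.toReal_ofReal']
  rw [max_comm]
  ring

variable {Ω : Type*} [MeasurableSpace Ω] {P : Measure Ω} {W : ℝ → Ω → ℝ}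

lemma IsTwoSidedBrownian.isProbabilityMeasure (hW : IsTwoSidedBrownian W P) :
    IsProbabilityMeasure P :=
  hW.pos.toIsPreBrownianReal.isGaussianProcess.isProbabilityMeasure

/-- The length of an interval overlap splits into the overlaps of the positive and negative parts. -/
lemma overlap_eq_add {a b c d : ℝ} :
    max 0 (min (b.toNNReal : ℝ) d.toNNReal - max (a.toNNReal : ℝ) c.toNNReal) +
      max 0 (min ((-a).toNNReal : ℝ) (-c).toNNReal - max ((-b).toNNReal : ℝ) (-d).toNNReal) =
      max 0 (min b d - max a c) := by
  simp only [Real.coe_toNNReal']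
  grind

/-- The stochastic integral of a step function is a centred Gaussian variable whose variance is
the squared `L²` norm of the step function. The increments split at the origin into increments of
the two independent halves of the Brownian motion. -/
lemma StepFun.hasLaw_integral (hW : IsTwoSidedBrownian W P) (s : StepFun) :
    HasLaw (s.integral W) (gaussianReal 0 (∫ x, s.toFun x ^ 2).toNNReal) P := by
  have := hW.isProbabilityMeasure
  have hp := hW.pos.toIsPreBrownianReal
  have hn := hW.neg.toIsPreBrownianReal
  let A : Ω → ℝ := fun ω => ∑ i, s.c i *
    (W ((s.b i).toNNReal : ℝ) ω - W ((s.a i).toNNReal : ℝ) ω)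
  let C : Ω → ℝ := fun ω => ∑ i, (- s.c i) *
    (W (-((-s.a i).toNNReal : ℝ)) ω - W (-((-s.b i).toNNReal : ℝ)) ω)
  have hA : HasGaussianLaw A P := hasGaussianLaw_sum_increments hp _ _ _
  have hC : HasGaussianLaw C P := hasGaussianLaw_sum_increments hn _ _ _
  have hAC : IndepFun A C P := by
    have := hW.indep.comp
      (φ := fun f : ℝ≥0 → ℝ => ∑ i, s.c i * (f (s.b i).toNNReal - f (s.a i).toNNReal))
      (ψ := fun f : ℝ≥0 → ℝ => ∑ i, (- s.c i) * (f (-s.a i).toNNReal - f (-s.b i).toNNReal))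
      (by fun_prop) (by fun_prop)
    exact this
  have h0 : ∀ᵐ ω ∂P, W 0 ω = 0 := by simpa using hp.eval_zero_ae_eq_zero
  have hae : s.integral W =ᵐ[P] fun ω => A ω + C ω := by
    filter_upwards [h0] with ω hω
    simp only [StepFun.integral, A, C, ← Finset.sum_add_distrib]
    have key : ∀ t : ℝ, W t ω = W (t.toNNReal : ℝ) ω + W (-((-t).toNNReal : ℝ)) ω := by
      intro t
      rcases le_total 0 t with ht | ht
      · rw [Real.toNNReal_of_nonpos (by linarith : -t ≤ 0), Real.coe_toNNReal _ ht]
        simp [hω]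
      · rw [Real.toNNReal_of_nonpos ht, Real.coe_toNNReal (-t) (by linarith)]
        simp [hω]
    refine Finset.sum_congr rfl fun i _ => ?_
    rw [key (s.b i), key (s.a i)]
    ring
  have hG : HasGaussianLaw (fun ω => A ω + C ω) P := (hAC.hasGaussianLaw hA hC).fun_add
  have hmean : ∫ ω, (A ω + C ω) ∂P = 0 := by
    rw [integral_add hA.integrable hC.integrable, integral_sum_increments hp,
      integral_sum_increments hn]
    simp
  have hvar : Var[fun ω => A ω + C ω; P] = ∫ x, s.toFun x ^ 2 := by
    rw [hAC.variance_fun_add hA.memLp_two hC.memLp_two, s.integral_toFun_sq]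
    have e1 := variance_sum_increments hp (x := fun i => (s.a i).toNNReal)
      (y := fun i => (s.b i).toNNReal) (fun i => Real.toNNReal_mono (s.a_le_b i)) s.c
    have e2 := variance_sum_increments hn (x := fun i => (-s.b i).toNNReal)
      (y := fun i => (-s.a i).toNNReal)
      (fun i => Real.toNNReal_mono (neg_le_neg (s.a_le_b i))) (fun i => - s.c i)
    simp only [A, C]
    rw [e1, e2]
    simp only [← Finset.sum_add_distrib]
    refine Finset.sum_congr rfl fun i _ => Finset.sum_congr rfl fun j _ => ?_
    rw [← overlap_eq_add (a := s.a i) (b := s.b i)]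
    ring
  refine HasLaw.congr ⟨hG.aemeasurable, ?_⟩ hae
  rw [hG.map_eq_gaussianReal, hmean, hvar]

lemma eLpNorm_two_eq_ofReal_sqrt {α : Type*} [MeasurableSpace α] {μ : Measure α} {f : α → ℝ}
    (hf : MemLp f 2 μ) : eLpNorm f 2 μ = ENNReal.ofReal (√(∫ x, f x ^ 2 ∂μ)) := by
  rw [← ofReal_lpNorm hf, lpNorm_eq_integral_norm_rpow_toReal (by simp) (by simp) hf.1,
    Real.sqrt_eq_rpow]
  simp

/-! ### Linear combinations and density of step functions -/

/-- The step function `x • s + y • t`. -/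
def StepFun.comb (x y : ℝ) (s t : StepFun) : StepFun where
  size := s.size + t.size
  a := Fin.append s.a t.a
  b := Fin.append s.b t.b
  a_le_b i := by
    refine Fin.addCases (fun i => ?_) (fun i => ?_) i
    · simpa using s.a_le_b i
    · simpa using t.a_le_b i
  c := Fin.append (fun i => x * s.c i) (fun i => y * t.c i)

lemma StepFun.comb_toFun (x y : ℝ) (s t : StepFun) (z : ℝ) :
    (StepFun.comb x y s t).toFun z = x * s.toFun z + y * t.toFun z := by
  have h : ∀ (A : Set ℝ) (c d : ℝ), A.indicator (fun _ => c * d) z =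
      c * A.indicator (fun _ => d) z := by
    intro A c d
    by_cases hz : z ∈ A <;> simp [hz]
  refine (Fin.sum_univ_add _).trans ?_
  simp only [StepFun.toFun, StepFun.comb, Fin.append_left, Fin.append_right, h, Finset.mul_sum]

lemma StepFun.comb_integral {Ω' : Type*} (W : ℝ → Ω' → ℝ) (x y : ℝ) (s t : StepFun) (ω : Ω') :
    (StepFun.comb x y s t).integral W ω = x * s.integral W ω + y * t.integral W ω := by
  refine (Fin.sum_univ_add _).trans ?_
  simp only [StepFun.integral, StepFun.comb, Fin.append_left, Fin.append_right,
    Finset.mul_sum, mul_assoc]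

lemma StepFun.memLp_integral (hW : IsTwoSidedBrownian W P) (s : StepFun) :
    MemLp (s.integral W) 2 P := (s.hasLaw_integral hW).hasGaussianLaw.memLp_two

/-- The Itô isometry for step functions. -/
lemma StepFun.eLpNorm_integral (hW : IsTwoSidedBrownian W P) (s : StepFun) :
    eLpNorm (s.integral W) 2 P = eLpNorm s.toFun 2 volume := by
  have := hW.isProbabilityMeasure
  have hl := s.hasLaw_integral hW
  rw [eLpNorm_two_eq_ofReal_sqrt (s.memLp_integral hW),
    eLpNorm_two_eq_ofReal_sqrt (s.memLp_toFun 2)]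
  have h0 : ∫ ω, s.integral W ω ∂P = 0 := by rw [hl.integral_eq, integral_id_gaussianReal]
  have hv := hl.variance_eq
  rw [variance_id_gaussianReal, variance_of_integral_eq_zero hl.aemeasurable h0,
    Real.coe_toNNReal _ (integral_nonneg fun x => sq_nonneg _)] at hv
  rw [hv]

lemma StepFun.eLpNorm_integral_sub (hW : IsTwoSidedBrownian W P) (s t : StepFun) :
    eLpNorm (s.integral W - t.integral W) 2 P = eLpNorm (s.toFun - t.toFun) 2 volume := by
  have h := (StepFun.comb 1 (-1) s t).eLpNorm_integral hW
  convert h using 2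
  · ext ω; simp [StepFun.comb_integral, sub_eq_add_neg]
  · ext ω; simp [StepFun.comb_toFun, sub_eq_add_neg]

/-- A continuous compactly supported function is approximated in `L²` by the step functions that
sample it on a fine equidistant partition. -/
lemma exists_stepFun_eLpNorm_sub_le_of_continuous {g : ℝ → ℝ} (hg : Continuous g)
    (hgc : HasCompactSupport g) {ε : ℝ} (hε : 0 < ε) :
    ∃ s : StepFun, eLpNorm (fun x => g x - s.toFun x) 2 volume ≤ ENNReal.ofReal ε := by
  obtain ⟨R₀, hR₀⟩ := hgc.isBounded.subset_ball (0 : ℝ)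
  obtain ⟨R, hR⟩ := exists_nat_gt (max R₀ 0)
  have hRpos : (0 : ℝ) < R := (le_max_right _ _).trans_lt hR
  have hzero : ∀ x, x ∉ Set.Ioc (-(R : ℝ)) R → g x = 0 := by
    intro x hx
    by_contra hne
    have h1 := hR₀ (subset_tsupport g hne)
    rw [Metric.mem_ball, dist_zero_right, Real.norm_eq_abs, abs_lt] at h1
    have h2 := (le_max_left R₀ 0).trans_lt hR
    exact hx ⟨by linarith, by linarith⟩
  set η : ℝ := ε / √(2 * R) with hη
  have hηpos : 0 < η := by positivity
  obtain ⟨δ, hδ, hu⟩ := Metric.uniformContinuous_iff.1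
    (hgc.uniformContinuous_of_continuous hg) η hηpos
  obtain ⟨N, hN⟩ := exists_nat_gt (1 / δ)
  have hNpos : (0 : ℝ) < N := (by positivity : (0 : ℝ) < 1 / δ).trans hN
  have hNδ : 1 / (N : ℝ) < δ := by
    rw [div_lt_iff₀ hNpos]; rw [div_lt_iff₀ hδ] at hN; linarith
  let s : StepFun :=
    { size := 2 * R * N
      a := fun i => -(R : ℝ) + (i : ℕ) / N
      b := fun i => -(R : ℝ) + ((i : ℕ) + 1) / N
      a_le_b := fun i => by gcongr; linarith
      c := fun i => g (-(R : ℝ) + ((i : ℕ) + 1) / N) }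
  have hmem : ∀ (x : ℝ) (i : ℕ), x ∈ Set.Ioc (-(R : ℝ) + (i : ℝ) / N) (-(R : ℝ) + (i + 1) / N) ↔
      (i : ℝ) < (x + R) * N ∧ (x + R) * N ≤ i + 1 := by
    intro x i
    rw [Set.mem_Ioc, ← lt_sub_iff_add_lt', ← sub_le_iff_le_add', div_lt_iff₀ hNpos,
      le_div_iff₀ hNpos]
    simp
  refine ⟨s, ?_⟩
  have hb : ∀ x, ‖g x - s.toFun x‖ ≤ ‖Set.indicator (Set.Ioc (-(R : ℝ)) R) (fun _ => η) x‖ := by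
    intro x
    by_cases hx : x ∈ Set.Ioc (-(R : ℝ)) R
    · rw [Set.indicator_of_mem hx, Real.norm_of_nonneg hηpos.le]
      have hy : 0 < (x + R) * N := mul_pos (by linarith [hx.1]) hNpos
      have hy2 : (x + R) * N ≤ 2 * R * N := by gcongr; linarith [hx.2]
      -- the index of the partition interval that contains `x`
      set k : ℕ := ⌈(x + R) * N⌉₊ - 1 with hk
      have hc1 : 1 ≤ ⌈(x + R) * N⌉₊ := Nat.one_le_ceil_iff.2 hy
      have hkc : (k : ℝ) + 1 = (⌈(x + R) * N⌉₊ : ℝ) := by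
        rw [hk]; push_cast [Nat.cast_sub hc1]; ring
      have hk1 : (k : ℝ) < (x + R) * N := by
        have := Nat.ceil_lt_add_one hy.le; linarith
      have hk2 : (x + R) * N ≤ k + 1 := by rw [hkc]; exact Nat.le_ceil _
      have hkn : k < 2 * R * N := by
        have : (k : ℝ) < ((2 * R * N : ℕ) : ℝ) := by push_cast; linarith
        exact_mod_cast this
      have hs : s.toFun x = g (-(R : ℝ) + ((k : ℝ) + 1) / N) := by
        rw [StepFun.toFun, Finset.sum_eq_single (⟨k, hkn⟩ : Fin s.size)]
        · exact Set.indicator_of_mem ((hmem x k).2 ⟨hk1, hk2⟩) _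
        · intro i _ hi
          refine Set.indicator_of_notMem (fun h => hi ?_) _
          have h' := (hmem x i).1 h
          have e1 : (i : ℕ) < k + 1 := by
            have : ((i : ℕ) : ℝ) < k + 1 := by linarith [h'.1]
            exact_mod_cast this
          have e2 : k < (i : ℕ) + 1 := by
            have : (k : ℝ) < (i : ℕ) + 1 := by linarith [h'.2]
            exact_mod_cast this
          exact Fin.ext (by simp only; omega)
        · simp
      rw [hs, ← dist_eq_norm]
      refine (hu ?_).le
      have hm := (hmem x k).2 ⟨hk1, hk2⟩
      rw [Real.dist_eq, abs_lt]
      rw [Set.mem_Ioc, add_div] at hm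
      rw [add_div]
      constructor <;> linarith [hm.1, hm.2]
    · rw [hzero x hx, StepFun.toFun, Finset.sum_eq_zero]
      · simp
      intro i _
      refine Set.indicator_of_notMem (fun h => hx ?_) _
      have h' := (hmem x i).1 h
      have hi : ((i : ℕ) : ℝ) + 1 ≤ 2 * R * N := by exact_mod_cast i.2
      constructor
      · have : 0 < (x + R) * N := lt_of_le_of_lt (Nat.cast_nonneg _) h'.1
        have := pos_of_mul_pos_left this hNpos.le
        linarith
      · have : (x + R) * N ≤ (2 * R) * N := by linarith [h'.2]
        have := le_of_mul_le_mul_right this hNpos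
        linarith
  refine (eLpNorm_mono hb).trans ?_
  rw [eLpNorm_indicator_const measurableSet_Ioc (by simp) (by simp), Real.volume_Ioc,
    Real.enorm_of_nonneg hηpos.le, ENNReal.ofReal_rpow_of_pos (by linarith),
    ← ENNReal.ofReal_mul hηpos.le]
  refine ENNReal.ofReal_le_ofReal (le_of_eq ?_)
  rw [hη, Real.sqrt_eq_rpow, show (R : ℝ) - -R = 2 * R by ring]
  have : (2 * (R : ℝ)) ^ (1 / 2 : ℝ) ≠ 0 := by positivity
  simp only [ENNReal.toReal_ofNat]
  field_simp

lemma exists_stepFun_tendsto {φ : ℝ → ℝ} (hφ : MemLp φ 2 volume) : ∃ s : ℕ → StepFun,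
    Tendsto (fun m => eLpNorm (fun x => φ x - (s m).toFun x) 2 volume) atTop (𝓝 0) := by
  have h : ∀ m : ℕ, ∃ s : StepFun, eLpNorm (fun x => φ x - s.toFun x) 2 volume ≤
      ENNReal.ofReal (2 * (1 / ((m : ℝ) + 1))) := by
    intro m
    have hpos : (0 : ℝ) < 1 / ((m : ℝ) + 1) := Nat.one_div_pos_of_nat
    obtain ⟨g, hgc, hgφ, hg, hgm⟩ := hφ.exists_hasCompactSupport_eLpNorm_sub_le (by simp)
      (ε := ENNReal.ofReal (1 / ((m : ℝ) + 1))) (by simpa using hpos)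
    obtain ⟨s, hs⟩ := exists_stepFun_eLpNorm_sub_le_of_continuous hg hgc hpos
    refine ⟨s, ?_⟩
    have he : (fun x => φ x - s.toFun x) = (φ - g) + fun x => g x - s.toFun x := by
      ext x; simp
    rw [he, two_mul, ENNReal.ofReal_add hpos.le hpos.le]
    exact (eLpNorm_add_le (hφ.sub hgm).1 (hgm.sub (s.memLp_toFun 2)).1 (by simp)).trans
      (add_le_add hgφ hs)
  choose s hs using h
  refine ⟨s, tendsto_of_tendsto_of_tendsto_of_le_of_le tendsto_const_nhds ?_
    (fun _ => zero_le) hs⟩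
  have := (tendsto_one_div_add_atTop_nhds_zero_nat (𝕜 := ℝ)).const_mul 2
  simpa using ENNReal.tendsto_ofReal this

/-! ### The Wiener integral -/

/-- The Itô isometry turns an approximating sequence of step functions into a Cauchy sequence of
integrals, whose limit is the Wiener integral. -/
lemma exists_isWienerIntegral (hW : IsTwoSidedBrownian W P) {φ : ℝ → ℝ}
    (hφ : MemLp φ 2 volume) : ∃ I, IsWienerIntegral P W φ I := by
  obtain ⟨s, hs⟩ := exists_stepFun_tendsto hφ
  let G : ℕ → Lp ℝ 2 (volume : Measure ℝ) := fun m => ((s m).memLp_toFun 2).toLp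
  let F : ℕ → Lp ℝ 2 P := fun m => ((s m).memLp_integral hW).toLp
  have hG : Tendsto G atTop (𝓝 hφ.toLp) := by
    rw [Lp.tendsto_Lp_iff_tendsto_eLpNorm'' _ _ _ hφ]
    refine hs.congr fun m => ?_
    exact eLpNorm_sub_comm φ (s m).toFun 2 volume
  have hF : CauchySeq F := by
    have hGc := hG.cauchySeq
    rw [EMetric.cauchySeq_iff] at hGc ⊢
    intro ε hε
    obtain ⟨N, hN⟩ := hGc ε hε
    refine ⟨N, fun m hm n hn => ?_⟩
    have := hN m hm n hn
    simp only [G, F, Lp.edist_toLp_toLp] at this ⊢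
    rwa [StepFun.eLpNorm_integral_sub hW]
  obtain ⟨I, hI⟩ := cauchySeq_tendsto_of_complete hF
  refine ⟨I, Lp.memLp I, s, hs, ?_⟩
  rw [← Lp.toLp_coeFn I (Lp.memLp I), Lp.tendsto_Lp_iff_tendsto_eLpNorm''] at hI
  refine hI.congr fun m => ?_
  exact eLpNorm_sub_comm _ _ 2 P

lemma isWienerIntegral_wienerIntegral (hW : IsTwoSidedBrownian W P) {φ : ℝ → ℝ}
    (hφ : MemLp φ 2 volume) : IsWienerIntegral P W φ (wienerIntegral P W φ) := by
  have h := exists_isWienerIntegral hW hφ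
  rw [wienerIntegral, dif_pos h]
  exact h.choose_spec

lemma IsWienerIntegral.congr {φ : ℝ → ℝ} {I J : Ω → ℝ} (h : IsWienerIntegral P W φ I)
    (hIJ : I =ᵐ[P] J) : IsWienerIntegral P W φ J := by
  obtain ⟨h1, s, h2, h3⟩ := h
  refine ⟨h1.ae_eq hIJ, s, h2, h3.congr fun m => eLpNorm_congr_ae ?_⟩
  filter_upwards [hIJ] with ω hω
  rw [hω]

lemma tendsto_eLpNorm_comb {α : Type*} [MeasurableSpace α] {μ : Measure α} (x y : ℝ)
    {f g : α → ℝ} {f' g' : ℕ → α → ℝ} (hf : MemLp f 2 μ) (hg : MemLp g 2 μ)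
    (hf' : ∀ m, MemLp (f' m) 2 μ) (hg' : ∀ m, MemLp (g' m) 2 μ)
    (h1 : Tendsto (fun m => eLpNorm (fun z => f z - f' m z) 2 μ) atTop (𝓝 0))
    (h2 : Tendsto (fun m => eLpNorm (fun z => g z - g' m z) 2 μ) atTop (𝓝 0)) :
    Tendsto (fun m => eLpNorm (fun z => x * f z + y * g z - (x * f' m z + y * g' m z)) 2 μ)
      atTop (𝓝 0) := by
  have h3 := (ENNReal.Tendsto.const_mul h1 (Or.inr (enorm_ne_top (x := x)))).add
    (ENNReal.Tendsto.const_mul h2 (Or.inr (enorm_ne_top (x := y))))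
  rw [mul_zero, mul_zero, add_zero] at h3
  refine tendsto_of_tendsto_of_tendsto_of_le_of_le tendsto_const_nhds h3
    (fun _ => zero_le) fun m => ?_
  have he : (fun z => x * f z + y * g z - (x * f' m z + y * g' m z)) =
      x • (f - f' m) + y • (g - g' m) := by
    ext z; simp; ring
  simp only [he]
  refine (eLpNorm_add_le ((hf.sub (hf' m)).const_smul x).1 ((hg.sub (hg' m)).const_smul y).1
    (by simp)).trans ?_
  rw [eLpNorm_const_smul, eLpNorm_const_smul]
  exact le_rfl

/-- Wiener integrals are linear in the integrand. -/
lemma IsWienerIntegral.comb (hW : IsTwoSidedBrownian W P) {φ χ : ℝ → ℝ} {I J : Ω → ℝ}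
    (hφ : MemLp φ 2 volume) (hχ : MemLp χ 2 volume)
    (hI : IsWienerIntegral P W φ I) (hJ : IsWienerIntegral P W χ J) (x y : ℝ) :
    IsWienerIntegral P W (fun z => x * φ z + y * χ z) (fun ω => x * I ω + y * J ω) := by
  obtain ⟨hI1, s, hs1, hs2⟩ := hI
  obtain ⟨hJ1, t, ht1, ht2⟩ := hJ
  refine ⟨(hI1.const_mul x).add (hJ1.const_mul y), fun m => StepFun.comb x y (s m) (t m), ?_, ?_⟩
  · simp only [StepFun.comb_toFun]
    exact tendsto_eLpNorm_comb x y hφ hχ (fun m => (s m).memLp_toFun 2)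
      (fun m => (t m).memLp_toFun 2) hs1 ht1
  · simp only [StepFun.comb_integral]
    exact tendsto_eLpNorm_comb x y hI1 hJ1 (fun m => (s m).memLp_integral hW)
      (fun m => (t m).memLp_integral hW) hs2 ht2

lemma tendsto_integral_sq_of_tendsto_eLpNorm {α : Type*} [MeasurableSpace α] {μ : Measure α}
    {f : α → ℝ} {f' : ℕ → α → ℝ} (hf : MemLp f 2 μ) (hf' : ∀ m, MemLp (f' m) 2 μ)
    (h : Tendsto (fun m => eLpNorm (fun z => f z - f' m z) 2 μ) atTop (𝓝 0)) :
    Tendsto (fun m => ∫ z, f' m z ^ 2 ∂μ) atTop (𝓝 (∫ z, f z ^ 2 ∂μ)) := by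
  have hn : ∀ g : α → ℝ, ∀ hg : MemLp g 2 μ, ∫ z, g z ^ 2 ∂μ = ‖hg.toLp‖ ^ 2 := by
    intro g hg
    rw [Lp.norm_toLp, eLpNorm_two_eq_ofReal_sqrt hg, ENNReal.toReal_ofReal (Real.sqrt_nonneg _),
      Real.sq_sqrt (integral_nonneg fun z => sq_nonneg _)]
  rw [hn f hf]
  simp_rw [fun m => hn _ (hf' m)]
  refine Tendsto.pow (Tendsto.norm ?_) 2
  rw [Lp.tendsto_Lp_iff_tendsto_eLpNorm'' _ _ _ hf]
  exact h.congr fun m => eLpNorm_sub_comm _ _ 2 μ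

/-- The Wiener integral of `φ` is centred Gaussian with variance `‖φ‖₂²`, as the limit of the
Gaussian integrals of step functions. -/
lemma IsWienerIntegral.hasLaw (hW : IsTwoSidedBrownian W P) {φ : ℝ → ℝ} {I : Ω → ℝ}
    (hφ : MemLp φ 2 volume) (hI : IsWienerIntegral P W φ I) :
    HasLaw I (gaussianReal 0 (∫ x, φ x ^ 2).toNNReal) P := by
  have := hW.isProbabilityMeasure
  obtain ⟨hI1, s, hs1, hs2⟩ := hI
  refine ⟨hI1.1.aemeasurable, ?_⟩
  have hm : TendstoInMeasure P (fun m => (s m).integral W) atTop I := by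
    refine tendstoInMeasure_of_tendsto_eLpNorm (p := 2) (by simp)
      (fun m => ((s m).memLp_integral hW).1) hI1.1 ?_
    exact hs2.congr fun m => eLpNorm_sub_comm _ _ 2 P
  have hd := (hm.tendstoInDistribution fun m => ((s m).hasLaw_integral hW).aemeasurable).tendsto
  have hd := ProbabilityMeasure.tendsto_iff_tendsto_charFun.1 hd
  have := Measure.isProbabilityMeasure_map hI1.1.aemeasurable (μ := P)
  refine Measure.ext_of_charFun (funext fun t => tendsto_nhds_unique (hd t) ?_)
  simp only [ProbabilityMeasure.coe_mk, ((s _).hasLaw_integral hW).map_eq, charFun_gaussianReal]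
  have hv := tendsto_integral_sq_of_tendsto_eLpNorm hφ (fun m => (s m).memLp_toFun 2) hs1
  simp only [Real.coe_toNNReal _ (integral_nonneg fun x => sq_nonneg (StepFun.toFun _ x)),
    Real.coe_toNNReal _ (integral_nonneg fun x => sq_nonneg (φ x))]
  refine (Complex.continuous_exp.tendsto _).comp (Tendsto.sub tendsto_const_nhds ?_)
  exact (((Complex.continuous_ofReal.tendsto _).comp hv).mul_const _).div_const _

/-- Wiener integrals of orthogonal functions are independent. -/
lemma IsWienerIntegral.indepFun (hW : IsTwoSidedBrownian W P) {φ χ : ℝ → ℝ} {I J : Ω → ℝ}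
    (hφ : MemLp φ 2 volume) (hχ : MemLp χ 2 volume)
    (hI : IsWienerIntegral P W φ I) (hJ : IsWienerIntegral P W χ J)
    (horth : ∫ z, φ z * χ z = 0) : IndepFun I J P := by
  have := hW.isProbabilityMeasure
  have mI := hI.1.1.aemeasurable
  have mJ := hJ.1.1.aemeasurable
  rw [indepFun_iff_charFun_prod mI mJ]
  intro t
  rw [(hI.hasLaw hW hφ).map_eq, (hJ.hasLaw hW hχ).map_eq, charFun_gaussianReal,
    charFun_gaussianReal]
  set x := t.ofLp.1
  set y := t.ofLp.2
  have hlaw := (hI.comb hW hφ hχ hJ x y).hasLaw hW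
    (φ := fun z => x * φ z + y * χ z) ((hφ.const_mul x).add (hχ.const_mul y))
  have h1 : charFun (P.map fun ω => WithLp.toLp 2 (I ω, J ω)) t =
      charFun (P.map fun ω => x * I ω + y * J ω) 1 := by
    rw [charFun_apply, charFun_apply, integral_map (by fun_prop) (by fun_prop),
      integral_map (by fun_prop) (by fun_prop)]
    simp [WithLp.prod_inner_apply, x, y, mul_comm]
  have h2 : ∫ z, (x * φ z + y * χ z) ^ 2 = x ^ 2 * (∫ z, φ z ^ 2) + y ^ 2 * ∫ z, χ z ^ 2 := by
    have hint : Integrable (fun z => φ z * χ z) := hφ.integrable_mul hχ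
    have e : ∀ z, (x * φ z + y * χ z) ^ 2 =
        x ^ 2 * φ z ^ 2 + 2 * x * y * (φ z * χ z) + y ^ 2 * χ z ^ 2 := fun z => by ring
    simp_rw [e]
    have i1 : Integrable (fun z => x ^ 2 * φ z ^ 2 + 2 * x * y * (φ z * χ z)) :=
      (hφ.integrable_sq.const_mul _).add (hint.const_mul _)
    rw [integral_add i1 (hχ.integrable_sq.const_mul _), integral_add (hφ.integrable_sq.const_mul _)
      (hint.const_mul _), integral_const_mul, integral_const_mul, integral_const_mul, horth]
    ring
  rw [h1, hlaw.map_eq, charFun_gaussianReal, ← Complex.exp_add,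
    Real.coe_toNNReal _ (integral_nonneg fun z => sq_nonneg _),
    Real.coe_toNNReal _ (integral_nonneg fun z => sq_nonneg _),
    Real.coe_toNNReal _ (integral_nonneg fun z => sq_nonneg _), h2]
  congr 1
  push_cast
  ring

/-! ### Gaussian estimates -/

lemma gaussianPDFReal_zero_one (x : ℝ) :
    gaussianPDFReal 0 1 x = (√(2 * Real.pi))⁻¹ * Real.exp (-x ^ 2 / 2) := by
  simp [gaussianPDFReal]

/-- Mills' upper bound for the Gaussian tail. -/
lemma gaussianReal_abs_ge_le {u : ℝ} (hu : 0 < u) :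
    gaussianReal 0 1 {x | u ≤ |x|} ≤ ENNReal.ofReal (Real.exp (-u ^ 2 / 2) / u) := by
  have hderiv : ∀ x ∈ Set.Ici u, HasDerivAt (fun x : ℝ => -Real.exp (-x ^ 2 / 2))
      (x * Real.exp (-x ^ 2 / 2)) x := by
    intro x _
    have h0 : HasDerivAt (fun x : ℝ => -x ^ 2 / 2) (-x) x :=
      ((hasDerivAt_pow 2 x).neg.div_const 2).congr_deriv (by push_cast; ring)
    exact h0.exp.neg.congr_deriv (by ring)
  have hlim : Tendsto (fun x : ℝ => -Real.exp (-x ^ 2 / 2)) atTop (𝓝 0) := by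
    have h1 : Tendsto (fun x : ℝ => x ^ 2 / 2) atTop atTop :=
      (tendsto_pow_atTop two_ne_zero).atTop_div_const two_pos
    have := (Real.tendsto_exp_neg_atTop_nhds_zero.comp h1).neg
    simp only [neg_zero] at this
    refine this.congr fun x => ?_
    simp [neg_div]
  have hnn : ∀ x ∈ Set.Ioi u, 0 ≤ x * Real.exp (-x ^ 2 / 2) := fun x hx =>
    mul_nonneg (hu.le.trans (le_of_lt hx)) (Real.exp_pos _).le
  have hint := integrableOn_Ioi_deriv_of_nonneg' hderiv hnn hlim
  have hval := integral_Ioi_of_hasDerivAt_of_nonneg' hderiv hnn hlim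
  have hIci : gaussianReal 0 1 (Set.Ici u) ≤
      ENNReal.ofReal ((√(2 * Real.pi))⁻¹ * (Real.exp (-u ^ 2 / 2) / u)) := by
    rw [gaussianReal_apply_eq_integral 0 one_ne_zero]
    refine ENNReal.ofReal_le_ofReal ?_
    rw [integral_Ici_eq_integral_Ioi]
    calc ∫ x in Set.Ioi u, gaussianPDFReal 0 1 x
        ≤ ∫ x in Set.Ioi u, (√(2 * Real.pi))⁻¹ / u * (x * Real.exp (-x ^ 2 / 2)) := by
          refine setIntegral_mono_on (integrable_gaussianPDFReal 0 1).integrableOn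
            (hint.const_mul _) measurableSet_Ioi fun x hx => ?_
          rw [gaussianPDFReal_zero_one, div_mul_eq_mul_div, le_div_iff₀ hu, mul_assoc,
            mul_comm _ u]
          have : u ≤ x := le_of_lt hx
          gcongr
      _ = (√(2 * Real.pi))⁻¹ * (Real.exp (-u ^ 2 / 2) / u) := by
          rw [integral_const_mul, hval]
          ring
  have hsplit : {x : ℝ | u ≤ |x|} ⊆ Set.Ici u ∪ (fun x => -x) ⁻¹' Set.Ici u := by
    intro x hx
    rcases le_abs.1 (show u ≤ |x| from hx) with h | h
    · exact Or.inl h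
    · exact Or.inr h
  have hneg : gaussianReal 0 1 ((fun x => -x) ⁻¹' Set.Ici u) = gaussianReal 0 1 (Set.Ici u) := by
    rw [← Measure.map_apply measurable_neg measurableSet_Ici, gaussianReal_map_neg, neg_zero]
  refine (measure_mono hsplit).trans ((measure_union_le _ _).trans ?_)
  rw [hneg]
  refine (add_le_add hIci hIci).trans ?_
  rw [← ENNReal.ofReal_add (by positivity) (by positivity)]
  refine ENNReal.ofReal_le_ofReal ?_
  have h2 : 2 ≤ √(2 * Real.pi) := Real.le_sqrt_of_sq_le (by linarith [Real.pi_gt_three])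
  have h3 : (√(2 * Real.pi))⁻¹ ≤ 2⁻¹ := inv_anti₀ two_pos h2
  have h4 : 0 ≤ Real.exp (-u ^ 2 / 2) / u := by positivity
  nlinarith

lemma le_gaussianReal_Icc {u : ℝ} (hu : 0 < u) :
    (√(2 * Real.pi))⁻¹ * Real.exp (-(u + 1 / u) ^ 2 / 2) / u ≤
      (gaussianReal 0 1).real (Set.Icc u (u + 1 / u)) := by
  have hpos : 0 < 1 / u := by positivity
  rw [Measure.real, gaussianReal_apply_eq_integral 0 one_ne_zero, ENNReal.toReal_ofReal
    (setIntegral_nonneg measurableSet_Icc fun x _ => gaussianPDFReal_nonneg _ _ _)]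
  have h := setIntegral_ge_of_const_le_real (μ := volume) (s := Set.Icc u (u + 1 / u))
    (f := gaussianPDFReal 0 1) (c := (√(2 * Real.pi))⁻¹ * Real.exp (-(u + 1 / u) ^ 2 / 2))
    measurableSet_Icc (by simp) (fun x hx => ?_) (integrable_gaussianPDFReal 0 1).integrableOn
  · refine le_trans (le_of_eq ?_) h
    simp only [Measure.real, Real.volume_Icc, add_sub_cancel_left, ENNReal.toReal_ofReal hpos.le]
    ring
  · rw [gaussianPDFReal_zero_one]
    have : 0 ≤ x := hu.le.trans hx.1
    have h2 : x ^ 2 ≤ (u + 1 / u) ^ 2 := pow_le_pow_left₀ this hx.2 2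
    gcongr

/-- The exponent in the ratio between the conditional density of one coordinate of a standard
bivariate Gaussian pair with correlation `r` and its marginal density. -/
lemma exponent_le {r x y v : ℝ} (hr : |r| ≤ 1 / 2) (hx : 0 ≤ x) (hy : 0 ≤ y) (hxv : x ≤ v)
    (hyv : y ≤ v) :
    -(y - r * x) ^ 2 / (2 * (1 - r ^ 2)) ≤ -y ^ 2 / 2 + |r| * v ^ 2 := by
  have hb := abs_le.1 hr
  have hpos : 0 < 1 - r ^ 2 := by nlinarith
  rw [div_le_iff₀ (by positivity)]
  have hxy : x * y ≤ v ^ 2 := by nlinarith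
  have hxy0 : 0 ≤ x * y := mul_nonneg hx hy
  rcases le_total 0 r with h | h
  · rw [abs_of_nonneg h]
    nlinarith [sq_nonneg (r * (x - y)), mul_nonneg (mul_nonneg h hpos.le) (sub_nonneg.2 hxy),
      mul_nonneg (mul_nonneg h hxy0) (mul_nonneg h (by linarith : 0 ≤ 1 - r)),
      mul_nonneg (mul_nonneg (mul_nonneg h h) h) hxy0]
  · rw [abs_of_nonpos h]
    have hr0 : 0 ≤ -r := by linarith
    nlinarith [sq_nonneg (r * (x - y)), mul_nonneg (mul_nonneg hr0 hpos.le) (sq_nonneg v),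
      mul_nonneg hr0 hxy0, sq_nonneg (r * x), sq_nonneg (r * y)]

lemma inv_sqrt_one_sub_sq_le {r : ℝ} (hr : |r| ≤ 1 / 2) :
    (√(1 - r ^ 2))⁻¹ ≤ Real.exp |r| := by
  have h0 := abs_nonneg r
  have hsq : r ^ 2 = |r| ^ 2 := (sq_abs r).symm
  have hpos : 0 < 1 - r ^ 2 := by rw [hsq]; nlinarith
  rw [inv_le_comm₀ (by positivity) (Real.exp_pos _), ← Real.exp_neg]
  refine Real.le_sqrt_of_sq_le ?_
  rw [← Real.exp_nat_mul]
  have h1 : Real.exp ((2 : ℕ) * -|r|) ≤ (1 + 2 * |r|)⁻¹ := by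
    rw [show ((2 : ℕ) : ℝ) * -|r| = -(2 * |r|) by push_cast; ring, Real.exp_neg]
    exact inv_anti₀ (by positivity) (by linarith [Real.add_one_le_exp (2 * |r|)])
  refine h1.trans ?_
  rw [inv_le_iff_one_le_mul₀ (by positivity), hsq]
  nlinarith [mul_nonneg h0 h0]

lemma gaussianReal_correlated_Icc_le {r x u v : ℝ} (hr : |r| ≤ 1 / 2) (hu : 0 ≤ u)
    (hx : x ∈ Set.Icc u v) :
    gaussianReal (r * x) (1 - r ^ 2).toNNReal (Set.Icc u v) ≤
      ENNReal.ofReal (Real.exp (|r| * (v ^ 2 + 1))) * gaussianReal 0 1 (Set.Icc u v) := by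
  have hb := abs_le.1 hr
  have hpos : 0 < 1 - r ^ 2 := by nlinarith
  rw [gaussianReal_apply _ (by simpa using hpos), gaussianReal_apply _ one_ne_zero,
    ← lintegral_const_mul _ (measurable_gaussianPDF 0 1)]
  refine setLIntegral_mono ((measurable_gaussianPDF 0 1).const_mul _) fun y hy => ?_
  rw [gaussianPDF, gaussianPDF, ← ENNReal.ofReal_mul (Real.exp_pos _).le]
  refine ENNReal.ofReal_le_ofReal ?_
  rw [gaussianPDFReal_zero_one, gaussianPDFReal, Real.coe_toNNReal _ hpos.le,
    Real.sqrt_mul (by positivity), mul_inv]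
  have h1 := inv_sqrt_one_sub_sq_le hr
  have h2 := Real.exp_le_exp.2
    (exponent_le (r := r) hr (hu.trans hx.1) (hu.trans hy.1) hx.2 hy.2)
  calc (√(2 * Real.pi))⁻¹ * (√(1 - r ^ 2))⁻¹ *
        Real.exp (-(y - r * x) ^ 2 / (2 * (1 - r ^ 2)))
      ≤ (√(2 * Real.pi))⁻¹ * Real.exp |r| * Real.exp (-y ^ 2 / 2 + |r| * v ^ 2) := by gcongr
    _ = Real.exp (|r| * (v ^ 2 + 1)) * ((√(2 * Real.pi))⁻¹ * Real.exp (-y ^ 2 / 2)) := by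
        rw [Real.exp_add, mul_add, Real.exp_add, mul_one]; ring

lemma measure_correlated_Icc_le [IsProbabilityMeasure P] {X V : Ω → ℝ} {r u v : ℝ}
    (hX : HasLaw X (gaussianReal 0 1) P) (hV : HasLaw V (gaussianReal 0 1) P)
    (hind : IndepFun X V P) (hr : |r| ≤ 1 / 2) (hu : 0 ≤ u) :
    P {ω | X ω ∈ Set.Icc u v ∧ r * X ω + √(1 - r ^ 2) * V ω ∈ Set.Icc u v} ≤
      ENNReal.ofReal (Real.exp (|r| * (v ^ 2 + 1))) * gaussianReal 0 1 (Set.Icc u v) ^ 2 := by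
  have hb := abs_le.1 hr
  have hpos : 0 < 1 - r ^ 2 := by nlinarith
  have hmap := (indepFun_iff_map_prod_eq_prod_map_map hX.aemeasurable hV.aemeasurable).1 hind
  rw [hX.map_eq, hV.map_eq] at hmap
  set T : Set (ℝ × ℝ) := {p | p.1 ∈ Set.Icc u v ∧ r * p.1 + √(1 - r ^ 2) * p.2 ∈ Set.Icc u v}
    with hT
  have hTm : MeasurableSet T :=
    (measurable_fst measurableSet_Icc).inter
      (measurableSet_Icc.preimage (f := fun p : ℝ × ℝ => r * p.1 + √(1 - r ^ 2) * p.2)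
        (by fun_prop))
  have h1 : P {ω | X ω ∈ Set.Icc u v ∧ r * X ω + √(1 - r ^ 2) * V ω ∈ Set.Icc u v} =
      (gaussianReal 0 1).prod (gaussianReal 0 1) T := by
    rw [← hmap, Measure.map_apply_of_aemeasurable
      (hX.aemeasurable.prodMk hV.aemeasurable) hTm]
    rfl
  have hsec : ∀ x, gaussianReal 0 1 (Prod.mk x ⁻¹' T) ≤ (Set.Icc u v).indicator (fun _ =>
      ENNReal.ofReal (Real.exp (|r| * (v ^ 2 + 1))) * gaussianReal 0 1 (Set.Icc u v)) x := by
    intro x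
    by_cases hx : x ∈ Set.Icc u v
    · rw [Set.indicator_of_mem hx]
      refine le_trans (le_of_eq ?_) (gaussianReal_correlated_Icc_le hr hu hx)
      have hlaw : (gaussianReal 0 1).map (fun y => r * x + √(1 - r ^ 2) * y) =
          gaussianReal (r * x) (1 - r ^ 2).toNNReal := by
        have : (fun y : ℝ => r * x + √(1 - r ^ 2) * y) =
            (fun z => r * x + z) ∘ fun y => √(1 - r ^ 2) * y := rfl
        rw [this, ← Measure.map_map (by fun_prop) (by fun_prop), gaussianReal_map_const_mul,
          gaussianReal_map_const_add]
        congr 1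
        · simp
        · ext
          simp [Real.sq_sqrt hpos.le, hpos.le]
      rw [← hlaw, Measure.map_apply (by fun_prop) measurableSet_Icc]
      congr 1
      ext y
      simp only [hT, Set.mem_preimage, Set.mem_ofPred_eq, hx, true_and]
    · rw [Set.indicator_of_notMem hx]
      have : Prod.mk x ⁻¹' T = ∅ := by
        ext y
        simp only [hT, Set.mem_preimage, Set.mem_ofPred_eq, hx, false_and, Set.mem_empty_iff_false]
      simp [this]
  rw [h1, Measure.prod_apply hTm]
  refine (lintegral_mono hsec).trans ?_
  rw [lintegral_indicator_const measurableSet_Icc, mul_assoc, ← sq]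

/-- Two Wiener integrals of functions with equal norms and correlation `r` hit `[u, v]`
simultaneously with almost the probability of independent variables, when `|r| v²` is small. -/
lemma IsWienerIntegral.measure_pair_Icc_le (hW : IsTwoSidedBrownian W P)
    {φ χ : ℝ → ℝ} {I J : Ω → ℝ} (hφ : MemLp φ 2 volume) (hχ : MemLp χ 2 volume)
    (hI : IsWienerIntegral P W φ I) (hJ : IsWienerIntegral P W χ J) {σ r u v : ℝ} (hσ : 0 < σ)
    (h1 : ∫ z, φ z ^ 2 = σ ^ 2) (h2 : ∫ z, χ z ^ 2 = σ ^ 2) (h3 : ∫ z, φ z * χ z = r * σ ^ 2)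
    (hr : |r| ≤ 1 / 2) (hu : 0 ≤ u) :
    P {ω | I ω / σ ∈ Set.Icc u v ∧ J ω / σ ∈ Set.Icc u v} ≤
      ENNReal.ofReal (Real.exp (|r| * (v ^ 2 + 1))) * gaussianReal 0 1 (Set.Icc u v) ^ 2 := by
  have := hW.isProbabilityMeasure
  have hb := abs_le.1 hr
  have hpos : 0 < 1 - r ^ 2 := by nlinarith
  set s := √(1 - r ^ 2) with hs
  have hspos : 0 < s := Real.sqrt_pos.2 hpos
  have hs2 : s ^ 2 = 1 - r ^ 2 := Real.sq_sqrt hpos.le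
  have hint : Integrable (fun z => φ z * χ z) := hφ.integrable_mul hχ
  -- the standardized integral of `φ`, and the standardized residual of `χ` after regression on `φ`
  have hX : IsWienerIntegral P W (fun z => σ⁻¹ * φ z + 0 * χ z) (fun ω => σ⁻¹ * I ω + 0 * J ω) :=
    hI.comb hW hφ hχ hJ _ _
  have hV := hI.comb hW hφ hχ hJ (-(r / (σ * s))) (1 / (σ * s))
  have mX : MemLp (fun z => σ⁻¹ * φ z + 0 * χ z) 2 volume :=
    (hφ.const_mul _).add (hχ.const_mul _)
  have mV : MemLp (fun z => -(r / (σ * s)) * φ z + 1 / (σ * s) * χ z) 2 volume :=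
    (hφ.const_mul _).add (hχ.const_mul _)
  have hquad : ∀ a b c d : ℝ, ∫ z, (a * φ z + b * χ z) * (c * φ z + d * χ z) =
      (a * c + b * d + (a * d + b * c) * r) * σ ^ 2 := by
    intro a b c d
    have e : ∀ z, (a * φ z + b * χ z) * (c * φ z + d * χ z) =
        a * c * φ z ^ 2 + b * d * χ z ^ 2 + (a * d + b * c) * (φ z * χ z) := fun z => by ring
    simp_rw [e]
    have i1 : Integrable (fun z => a * c * φ z ^ 2 + b * d * χ z ^ 2) :=
      (hφ.integrable_sq.const_mul _).add (hχ.integrable_sq.const_mul _)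
    rw [integral_add i1 (hint.const_mul _), integral_add (hφ.integrable_sq.const_mul _)
      (hχ.integrable_sq.const_mul _), integral_const_mul, integral_const_mul,
      integral_const_mul, h1, h2, h3]
    ring
  have hind := hX.indepFun hW mX mV hV (by
    rw [hquad]
    field_simp
    ring)
  have lX := hX.hasLaw hW mX
  have lV := hV.hasLaw hW mV
  have eX : ∫ z, (σ⁻¹ * φ z + 0 * χ z) ^ 2 = 1 := by
    simp_rw [sq (_ + _)]
    rw [hquad]
    field_simp
    ring
  have eV : ∫ z, (-(r / (σ * s)) * φ z + 1 / (σ * s) * χ z) ^ 2 = 1 := by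
    simp_rw [sq (_ + _)]
    rw [hquad]
    field_simp
    rw [hs2]
    ring
  rw [eX, Real.toNNReal_one] at lX
  rw [eV, Real.toNNReal_one] at lV
  refine le_trans (le_of_eq ?_) (measure_correlated_Icc_le lX lV hind hr hu)
  congr 1
  ext ω
  have a1 : σ⁻¹ * I ω + 0 * J ω = I ω / σ := by ring
  have a2 : r * (I ω / σ) + s * (-(r / (σ * s)) * I ω + 1 / (σ * s) * J ω) = J ω / σ := by
    field_simp
    ring
  simp only [Set.mem_ofPred_eq, a1]
  rw [← hs, a2]

/-! ### The second moment method -/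

lemma sum_sub_le {f : ℕ → ℝ} (hf : ∀ k, 0 ≤ f k) {i M : ℕ} (hi : i < M) :
    ∑ j ∈ Finset.range M, (if j < i then f (i - j) else 0) ≤ ∑ k ∈ Finset.Ico 1 M, f k := by
  rw [← Finset.sum_filter]
  have hinj : Set.InjOn (fun j => i - j) ((Finset.range M).filter (· < i) : Set ℕ) := by
    intro a ha b hb hab
    simp only [Finset.coe_filter, Set.mem_ofPred_eq] at ha hb hab
    omega
  rw [← Finset.sum_image (f := f) hinj]
  refine Finset.sum_le_sum_of_subset_of_nonneg (fun k hk => ?_) fun k _ _ => hf k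
  simp only [Finset.mem_image, Finset.mem_filter, Finset.mem_range, Finset.mem_Ico] at hk ⊢
  obtain ⟨j, hj, rfl⟩ := hk
  omega

lemma sum_sub_le' {f : ℕ → ℝ} (hf : ∀ k, 0 ≤ f k) (i M : ℕ) :
    ∑ j ∈ Finset.range M, (if i < j then f (j - i) else 0) ≤ ∑ k ∈ Finset.Ico 1 M, f k := by
  rw [← Finset.sum_filter]
  have hinj : Set.InjOn (fun j => j - i) ((Finset.range M).filter (i < ·) : Set ℕ) := by
    intro a ha b hb hab
    simp only [Finset.coe_filter, Set.mem_ofPred_eq] at ha hb hab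
    omega
  rw [← Finset.sum_image (f := f) hinj]
  refine Finset.sum_le_sum_of_subset_of_nonneg (fun k hk => ?_) fun k _ _ => hf k
  simp only [Finset.mem_image, Finset.mem_filter, Finset.mem_range, Finset.mem_Ico] at hk ⊢
  obtain ⟨j, hj, rfl⟩ := hk
  omega

/-- If events of equal probability `p` are pairwise positively correlated by at most the factor
`c (j - i)`, then Chebyshev's inequality for the number of events that occur bounds the probability
that none occurs. -/
lemma measure_forall_notMem_le [IsProbabilityMeasure P] {A : ℕ → Set Ω} {M : ℕ} {p : ℝ}
    {c : ℕ → ℝ} (hM : 0 < M) (hp : 0 < p)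
    (hA : ∀ i < M, NullMeasurableSet (A i) P) (hpA : ∀ i < M, P.real (A i) = p)
    (hc : ∀ k, 1 ≤ c k)
    (hAA : ∀ i j, i < j → j < M → P.real (A i ∩ A j) ≤ p ^ 2 * c (j - i)) :
    P.real {ω | ∀ i < M, ω ∉ A i} ≤
      1 / (M * p) + 2 * ((1 / M) * ∑ k ∈ Finset.Ico 1 M, (c k - 1)) := by
  have hMpos : (0 : ℝ) < M := by exact_mod_cast hM
  set S := ∑ k ∈ Finset.Ico 1 M, (c k - 1) with hS
  let g : ℕ → Ω → ℝ := fun i => (A i).indicator (fun _ => 1)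
  -- the centred number of events that occur
  let N : Ω → ℝ := fun ω => ∑ i ∈ Finset.range M, (g i ω - p)
  have hgi : ∀ i < M, Integrable (g i) P := fun i hi =>
    IntegrableOn.integrable_indicator₀ (integrableOn_const (by simp)) (hA i hi)
  have hgint : ∀ i < M, ∫ ω, g i ω ∂P = p := fun i hi => by
    rw [integral_indicator₀ (hA i hi)]
    simpa using hpA i hi
  have hgg : ∀ i j, (fun ω => g i ω * g j ω) = (A i ∩ A j).indicator fun _ => (1 : ℝ) := by
    intro i j
    ext ω
    simp only [g]
    rw [show (fun _ : Ω => (1 : ℝ)) = fun _ => 1 * 1 by simp, Set.inter_indicator_mul]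
    simp
  have hggi : ∀ i < M, ∀ j < M, Integrable (fun ω => g i ω * g j ω) P := fun i hi j hj => by
    rw [hgg]
    exact IntegrableOn.integrable_indicator₀ (integrableOn_const (by simp))
      ((hA i hi).inter (hA j hj))
  have hggint : ∀ i < M, ∀ j < M, ∫ ω, g i ω * g j ω ∂P = P.real (A i ∩ A j) :=
      fun i hi j hj => by
    rw [hgg, integral_indicator₀ ((hA i hi).inter (hA j hj))]
    simp
  have e : ∀ i j, (fun ω => (g i ω - p) * (g j ω - p)) =
      fun ω => g i ω * g j ω - p * g i ω - p * g j ω + p ^ 2 := by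
    intro i j; ext ω; ring
  have i1 : ∀ i < M, ∀ j < M, Integrable (fun ω => g i ω * g j ω - p * g i ω) P :=
    fun i hi j hj => (hggi i hi j hj).sub ((hgi i hi).const_mul p)
  have i2 : ∀ i < M, ∀ j < M, Integrable (fun ω => g i ω * g j ω - p * g i ω - p * g j ω) P :=
    fun i hi j hj => (i1 i hi j hj).sub ((hgi j hj).const_mul p)
  have hei : ∀ i < M, ∀ j < M, Integrable (fun ω => (g i ω - p) * (g j ω - p)) P :=
    fun i hi j hj => by rw [e]; exact (i2 i hi j hj).add (integrable_const _)
  have heint : ∀ i < M, ∀ j < M, ∫ ω, (g i ω - p) * (g j ω - p) ∂P =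
      P.real (A i ∩ A j) - p ^ 2 := fun i hi j hj => by
    rw [e, integral_add (i2 i hi j hj) (integrable_const _), integral_sub (i1 i hi j hj)
      ((hgi j hj).const_mul p), integral_sub (hggi i hi j hj) ((hgi i hi).const_mul p),
      integral_const_mul, integral_const_mul, hggint i hi j hj, hgint i hi, hgint j hj]
    simp
    ring
  have hNsq : ∀ ω, N ω ^ 2 =
      ∑ i ∈ Finset.range M, ∑ j ∈ Finset.range M, (g i ω - p) * (g j ω - p) := fun ω => by
    rw [sq, Finset.sum_mul_sum]
  have hNi : Integrable (fun ω => N ω ^ 2) P := by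
    simp_rw [hNsq]
    exact integrable_finsetSum _ fun i hi => integrable_finsetSum _ fun j hj =>
      hei i (Finset.mem_range.1 hi) j (Finset.mem_range.1 hj)
  have hf : ∀ k, 0 ≤ p ^ 2 * (c k - 1) := fun k => mul_nonneg (sq_nonneg p) (by linarith [hc k])
  have hvar : ∫ ω, N ω ^ 2 ∂P ≤ M * p + 2 * (M * (p ^ 2 * S)) := by
    simp_rw [hNsq]
    rw [integral_finsetSum _ fun i hi => integrable_finsetSum _ fun j hj =>
      hei i (Finset.mem_range.1 hi) j (Finset.mem_range.1 hj)]
    have hrow : ∀ i ∈ Finset.range M, ∫ ω, ∑ j ∈ Finset.range M, (g i ω - p) * (g j ω - p) ∂P ≤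
        p + 2 * (p ^ 2 * S) := by
      intro i hi
      have hi' := Finset.mem_range.1 hi
      rw [integral_finsetSum _ fun j hj => hei i hi' j (Finset.mem_range.1 hj)]
      have hterm : ∀ j ∈ Finset.range M, ∫ ω, (g i ω - p) * (g j ω - p) ∂P ≤
          (if i = j then p else 0) + (if j < i then p ^ 2 * (c (i - j) - 1) else 0) +
            (if i < j then p ^ 2 * (c (j - i) - 1) else 0) := by
        intro j hj
        have hj' := Finset.mem_range.1 hj
        rw [heint i hi' j hj']
        rcases lt_trichotomy i j with h | h | h
        · simp only [h.ne, h.not_gt, h, if_true, if_false]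
          linarith [hAA i j h hj']
        · subst h
          simp only [lt_irrefl, if_true, if_false, Set.inter_self, hpA i hi']
          linarith [sq_nonneg p]
        · simp only [h.ne', h.not_gt, h, if_true, if_false]
          rw [Set.inter_comm]
          linarith [hAA j i h hi']
      refine (Finset.sum_le_sum hterm).trans ?_
      rw [Finset.sum_add_distrib, Finset.sum_add_distrib, Finset.sum_ite_eq, if_pos hi]
      have h1 := sum_sub_le hf hi'
      have h2 := sum_sub_le' hf i M
      rw [← Finset.mul_sum] at h1 h2
      linarith
    refine (Finset.sum_le_sum hrow).trans (le_of_eq ?_)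
    rw [Finset.sum_const, Finset.card_range, nsmul_eq_mul]
    ring
  have hmarkov := mul_meas_ge_le_integral_of_nonneg (μ := P) (f := fun ω => N ω ^ 2)
    (Eventually.of_forall fun ω => sq_nonneg (N ω)) hNi ((M * p) ^ 2)
  have hsub : {ω | ∀ i < M, ω ∉ A i} ⊆ {ω | (M * p) ^ 2 ≤ N ω ^ 2} := by
    intro ω hω
    have : N ω = -(M * p) := by
      simp only [N]
      rw [Finset.sum_congr rfl fun i hi => by
        rw [show g i ω = 0 from Set.indicator_of_notMem (hω i (Finset.mem_range.1 hi)) _]]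
      simp
    simp [this]
  have hmono := measureReal_mono (μ := P) hsub
  have hfin : (M * p) ^ 2 * P.real {ω | ∀ i < M, ω ∉ A i} ≤ M * p + 2 * (M * (p ^ 2 * S)) :=
    (mul_le_mul_of_nonneg_left hmono (sq_nonneg _)).trans (hmarkov.trans hvar)
  have hpos : (0 : ℝ) < (M * p) ^ 2 := by positivity
  rw [mul_comm, ← le_div_iff₀ hpos] at hfin
  refine hfin.trans (le_of_eq ?_)
  field_simp

/-! ### Asymptotics of the threshold -/

/-- The level that a standardized Wiener integral has to exceed for its calibrated statistic to
exceed `c`, in terms of `L = log (ν / h)`. -/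
noncomputable def threshold (c L : ℝ) : ℝ := √(2 * L) + c * (Real.log L / √(1 / 2 * L))

lemma threshold_sq {c L : ℝ} (hL : 0 < L) :
    threshold c L ^ 2 = 2 * (L + 2 * c * Real.log L + c ^ 2 * (Real.log L ^ 2 / L)) := by
  have h1 : √(2 * L) = 2 * √(1 / 2 * L) := by
    rw [show 2 * L = 2 ^ 2 * (1 / 2 * L) by ring, Real.sqrt_mul (by positivity),
      Real.sqrt_sq (by norm_num)]
  have h2 : √(1 / 2 * L) ^ 2 = 1 / 2 * L := Real.sq_sqrt (by positivity)
  have h3 : 0 < √(1 / 2 * L) := Real.sqrt_pos.2 (by positivity)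
  rw [threshold, h1]
  have e : (2 * √(1 / 2 * L) + c * (Real.log L / √(1 / 2 * L))) ^ 2 =
      4 * √(1 / 2 * L) ^ 2 + 4 * c * Real.log L + c ^ 2 * (Real.log L ^ 2 / √(1 / 2 * L) ^ 2) := by
    field_simp
    ring
  rw [e, h2]
  field_simp
  ring

lemma tendsto_log_sq_div : Tendsto (fun L : ℝ => Real.log L ^ 2 / L) atTop (𝓝 0) := by
  simpa using Real.tendsto_pow_log_div_mul_add_atTop 1 0 2 one_ne_zero

lemma eventually_sqrt_le_threshold (c : ℝ) : ∀ᶠ L in atTop, √L ≤ threshold c L := by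
  have h : Tendsto (fun L : ℝ => 2 * (c * (Real.log L / L))) atTop (𝓝 0) := by
    have := (((Real.tendsto_pow_log_div_mul_add_atTop 1 0 1 one_ne_zero).const_mul c).const_mul 2)
    simpa using this
  filter_upwards [eventually_gt_atTop 0, h.eventually_const_lt (by norm_num : (-(1 / 2) : ℝ) < 0)]
    with L hL hlt
  have hs : 0 < √(1 / 2 * L) := Real.sqrt_pos.2 (by positivity)
  have h2 : √(1 / 2 * L) ^ 2 = 1 / 2 * L := Real.sq_sqrt (by positivity)
  have h1 : √(2 * L) = 2 * √(1 / 2 * L) := by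
    rw [show 2 * L = 2 ^ 2 * (1 / 2 * L) by ring, Real.sqrt_mul (by positivity),
      Real.sqrt_sq (by norm_num)]
  have e : c * (Real.log L / √(1 / 2 * L)) = √(1 / 2 * L) * (2 * (c * (Real.log L / L))) := by
    have h4 : Real.log L / √(1 / 2 * L) = √(1 / 2 * L) * (2 * (Real.log L / L)) := by
      rw [div_eq_iff hs.ne', show √(1 / 2 * L) * (2 * (Real.log L / L)) * √(1 / 2 * L) =
        2 * √(1 / 2 * L) ^ 2 * (Real.log L / L) by ring, h2]
      field_simp
    rw [h4]
    ring
  rw [threshold, e, h1]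
  have h3 : √L ≤ 3 / 2 * √(1 / 2 * L) := by
    refine Real.sqrt_le_iff.2 ⟨by positivity, ?_⟩
    rw [mul_pow, h2]
    linarith
  nlinarith

lemma threshold_le {c L : ℝ} (hc : c ≤ 0) (hL : 1 ≤ L) : threshold c L ≤ √(2 * L) := by
  have : 0 ≤ Real.log L / √(1 / 2 * L) := div_nonneg (Real.log_nonneg hL) (Real.sqrt_nonneg _)
  rw [threshold]
  nlinarith

/-- Above the critical level the expected number of exceedances, with the tail bounded by Mills'
inequality, vanishes. -/
lemma tendsto_exp_mul_tail {ε : ℝ} (hε : 0 < ε) :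
    Tendsto (fun L => Real.exp L * (Real.exp (-threshold (-1 / 4 + ε) L ^ 2 / 2) /
      threshold (-1 / 4 + ε) L)) atTop (𝓝 0) := by
  have hlim : Tendsto (fun L : ℝ => L ^ (-(2 * ε))) atTop (𝓝 0) :=
    tendsto_rpow_neg_atTop (by positivity)
  refine tendsto_of_tendsto_of_tendsto_of_le_of_le' tendsto_const_nhds hlim ?_ ?_
  · filter_upwards [eventually_sqrt_le_threshold (-1 / 4 + ε)] with L hL
    have := (Real.sqrt_nonneg L).trans hL
    positivity
  · filter_upwards [eventually_sqrt_le_threshold (-1 / 4 + ε), eventually_gt_atTop 0] with L h1 hL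
    have hs : 0 < √L := Real.sqrt_pos.2 hL
    rw [← mul_div_assoc, ← Real.exp_add, div_le_iff₀ (hs.trans_le h1)]
    refine le_trans ?_ (mul_le_mul_of_nonneg_left h1 (by positivity))
    rw [Real.sqrt_eq_rpow, ← Real.rpow_add hL, Real.rpow_def_of_pos hL]
    refine Real.exp_le_exp.2 ?_
    rw [neg_div, threshold_sq hL]
    have : 0 ≤ (-1 / 4 + ε) ^ 2 * (Real.log L ^ 2 / L) := by positivity
    linarith

/-- Below the critical level the expected number of exceedances tends to infinity. -/
lemma tendsto_exp_mul_density {ε : ℝ} (hε : 0 < ε) :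
    Tendsto (fun L => Real.exp L * ((√(2 * Real.pi))⁻¹ *
      Real.exp (-(threshold (-1 / 4 - ε) L + 1 / threshold (-1 / 4 - ε) L) ^ 2 / 2) /
        threshold (-1 / 4 - ε) L)) atTop atTop := by
  have hlim : Tendsto (fun L : ℝ => (√(2 * Real.pi))⁻¹ * Real.exp (-3) / √2 * L ^ (2 * ε))
      atTop atTop :=
    (tendsto_rpow_atTop (by positivity)).const_mul_atTop (by positivity)
  have hsmall := (tendsto_log_sq_div.const_mul ((-1 / 4 - ε) ^ 2)).eventually_lt_const
    (by norm_num : (-1 / 4 - ε) ^ 2 * 0 < 1)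
  refine tendsto_atTop_mono' _ ?_ hlim
  filter_upwards [eventually_sqrt_le_threshold (-1 / 4 - ε), eventually_ge_atTop 1, hsmall]
    with L h1 hL hsm
  have hL0 : 0 < L := by linarith
  set u := threshold (-1 / 4 - ε) L with hu
  have hu1 : 1 ≤ u := (Real.one_le_sqrt.2 hL).trans h1
  have hu0 : 0 < u := by linarith
  have hule : u ≤ √2 * √L := by
    rw [← Real.sqrt_mul (by norm_num)]
    exact threshold_le (by linarith) hL
  have hsq : (u + 1 / u) ^ 2 ≤ u ^ 2 + 3 := by
    have h2 : 1 / u ≤ 1 := (div_le_one hu0).2 hu1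
    have h3 : (u + 1 / u) ^ 2 = u ^ 2 + 2 + (1 / u) ^ 2 := by field_simp; ring
    have h4 : 0 ≤ 1 / u := by positivity
    nlinarith
  have hs : 0 < √L := Real.sqrt_pos.2 hL0
  have hs2 : 0 < √(2 : ℝ) := by positivity
  have hkey : Real.exp (-3) * L ^ (2 * ε) * √L ≤ Real.exp L * Real.exp (-(u + 1 / u) ^ 2 / 2) := by
    rw [Real.sqrt_eq_rpow, mul_assoc, ← Real.rpow_add hL0, Real.rpow_def_of_pos hL0,
      ← Real.exp_add, ← Real.exp_add]
    refine Real.exp_le_exp.2 ?_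
    have := threshold_sq (c := -1 / 4 - ε) hL0
    rw [← hu] at this
    rw [neg_div]
    linarith
  have hfinal : Real.exp (-3) / √2 * L ^ (2 * ε) ≤
      Real.exp L * Real.exp (-(u + 1 / u) ^ 2 / 2) / u := by
    rw [le_div_iff₀ hu0]
    refine le_trans ?_ hkey
    calc Real.exp (-3) / √2 * L ^ (2 * ε) * u ≤ Real.exp (-3) / √2 * L ^ (2 * ε) * (√2 * √L) := by
          gcongr
      _ = Real.exp (-3) * L ^ (2 * ε) * √L := by field_simp
  calc (√(2 * Real.pi))⁻¹ * Real.exp (-3) / √2 * L ^ (2 * ε)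
      = (√(2 * Real.pi))⁻¹ * (Real.exp (-3) / √2 * L ^ (2 * ε)) := by ring
    _ ≤ (√(2 * Real.pi))⁻¹ * (Real.exp L * Real.exp (-(u + 1 / u) ^ 2 / 2) / u) := by gcongr
    _ = _ := by ring

/-- Correlations of order `o(1 / log j)` have a negligible influence: only the at most `√M` pairs at
distance up to `√M` can have a large exponent, and these are outnumbered because all correlations
are small. -/
lemma tendsto_average_exp_correlation {b : ℕ → ℝ} (hb0 : ∀ j, 0 ≤ b j)
    (hb : ∀ j, 1 ≤ j → b j ≤ 1 / 18)
    (hlog : Tendsto (fun j : ℕ => Real.log j * b j) atTop (𝓝 0)) :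
    Tendsto (fun M : ℕ => 1 / (M : ℝ) *
      ∑ j ∈ Finset.Ico 1 M, (Real.exp (9 / 2 * Real.log M * b j) - 1)) atTop (𝓝 0) := by
  have hnn : ∀ M : ℕ, 0 ≤ 1 / (M : ℝ) *
      ∑ j ∈ Finset.Ico 1 M, (Real.exp (9 / 2 * Real.log M * b j) - 1) := by
    intro M
    refine mul_nonneg (by positivity) (Finset.sum_nonneg fun j hj => ?_)
    have : 0 ≤ 9 / 2 * Real.log M * b j :=
      mul_nonneg (mul_nonneg (by norm_num) (Real.log_natCast_nonneg M)) (hb0 j)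
    linarith [Real.one_le_exp this]
  rw [Metric.tendsto_atTop']
  intro δ hδ
  obtain ⟨η, hη, hηδ⟩ : ∃ η : ℝ, 0 < η ∧ Real.exp (9 * η) - 1 < δ / 2 := by
    have hcont : Tendsto (fun η : ℝ => Real.exp (9 * η) - 1) (𝓝[>] 0) (𝓝 0) := by
      have : Continuous fun η : ℝ => Real.exp (9 * η) - 1 := by fun_prop
      have h := this.tendsto 0
      simp only [mul_zero, Real.exp_zero, sub_self] at h
      exact h.mono_left nhdsWithin_le_nhds
    obtain ⟨η, h1, h2⟩ := ((hcont.eventually_lt_const (half_pos hδ)).and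
      self_mem_nhdsWithin).exists
    exact ⟨η, h2, h1⟩
  obtain ⟨J, hJ⟩ := eventually_atTop.1 (hlog.eventually_lt_const hη)
  have hdecay : Tendsto (fun M : ℕ => (M : ℝ) ^ (-(1 / 4) : ℝ)) atTop (𝓝 0) :=
    (tendsto_rpow_neg_atTop (by norm_num)).comp tendsto_natCast_atTop_atTop
  obtain ⟨M₀, hM₀⟩ := eventually_atTop.1 (hdecay.eventually_lt_const (half_pos hδ))
  refine ⟨max (max J 1 ^ 2) M₀ , fun M hM => ?_⟩
  have hMJ : (max J 1) ^ 2 < M := (le_max_left _ _).trans_lt hM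
  have hM1 : 1 < M := lt_of_le_of_lt (Nat.one_le_pow _ _ (by omega)) hMJ
  have hMpos : (0 : ℝ) < M := by exact_mod_cast (by omega : 0 < M)
  have hlogM : 0 < Real.log M := Real.log_pos (by exact_mod_cast hM1)
  have hterm : ∀ j ∈ Finset.Ico 1 M, Real.exp (9 / 2 * Real.log M * b j) - 1 ≤
      (if j * j ≤ M then (M : ℝ) ^ (1 / 4 : ℝ) else 0) + (Real.exp (9 * η) - 1) := by
    intro j hj
    have hj1 := (Finset.mem_Ico.1 hj).1
    have hjpos : (0 : ℝ) < j := by exact_mod_cast hj1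
    have hη1 : 0 ≤ Real.exp (9 * η) - 1 := by linarith [Real.one_le_exp (by positivity : 0 ≤ 9 * η)]
    split_ifs with hjM
    -- the bound `b j ≤ 1 / 18` caps the exponent at `(log M) / 4`
    · have : Real.exp (9 / 2 * Real.log M * b j) ≤ (M : ℝ) ^ (1 / 4 : ℝ) := by
        rw [Real.rpow_def_of_pos hMpos]
        refine Real.exp_le_exp.2 ?_
        nlinarith [hb j hj1]
      linarith
    · rw [zero_add]
      refine sub_le_sub_right (Real.exp_le_exp.2 ?_) 1
      have hJj : J ≤ j := by
        by_contra hlt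
        have : j * j ≤ max J 1 ^ 2 := by
          rw [sq]; exact Nat.mul_le_mul (by omega) (by omega)
        omega
      have h1 := hJ j hJj
      have h2 : Real.log M ≤ 2 * Real.log j := by
        rw [two_mul, ← Real.log_mul hjpos.ne' hjpos.ne']
        refine Real.log_le_log hMpos ?_
        exact_mod_cast (not_le.1 hjM).le
      nlinarith [mul_le_mul_of_nonneg_right h2 (hb0 j)]
  have hcard : (((Finset.Ico 1 M).filter fun j => j * j ≤ M).card : ℝ) ≤ (M : ℝ) ^ (1 / 2 : ℝ) := by
    have hsub : (Finset.Ico 1 M).filter (fun j => j * j ≤ M) ⊆ Finset.Ico 1 (Nat.sqrt M + 1) := by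
      intro j hj
      simp only [Finset.mem_filter, Finset.mem_Ico] at hj ⊢
      exact ⟨hj.1.1, Nat.lt_succ_of_le (Nat.le_sqrt.2 hj.2)⟩
    have := Finset.card_le_card hsub
    rw [Nat.card_Ico, Nat.add_sub_cancel] at this
    rw [← Real.sqrt_eq_rpow]
    exact (Nat.cast_le.2 this).trans Real.nat_sqrt_le_real_sqrt
  have hsum : ∑ j ∈ Finset.Ico 1 M, (Real.exp (9 / 2 * Real.log M * b j) - 1) ≤
      (M : ℝ) ^ (1 / 2 : ℝ) * (M : ℝ) ^ (1 / 4 : ℝ) + M * (Real.exp (9 * η) - 1) := by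
    refine (Finset.sum_le_sum hterm).trans ?_
    rw [Finset.sum_add_distrib, ← Finset.sum_filter, Finset.sum_const, Finset.sum_const,
      nsmul_eq_mul, nsmul_eq_mul, Nat.card_Ico]
    have hη1 : 0 ≤ Real.exp (9 * η) - 1 := by linarith [Real.one_le_exp (by positivity : 0 ≤ 9 * η)]
    have : ((M - 1 : ℕ) : ℝ) ≤ M := by exact_mod_cast Nat.sub_le M 1
    gcongr
  rw [Real.dist_0_eq_abs, abs_of_nonneg (hnn M)]
  have hbound := mul_le_mul_of_nonneg_left hsum (by positivity : 0 ≤ 1 / (M : ℝ))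
  have hpow : 1 / (M : ℝ) * ((M : ℝ) ^ (1 / 2 : ℝ) * (M : ℝ) ^ (1 / 4 : ℝ)) =
      (M : ℝ) ^ (-(1 / 4) : ℝ) := by
    rw [one_div, ← Real.rpow_neg_one, ← Real.rpow_add hMpos, ← Real.rpow_add hMpos]
    norm_num
  have hsecond : 1 / (M : ℝ) * (M * (Real.exp (9 * η) - 1)) = Real.exp (9 * η) - 1 := by
    field_simp
  rw [mul_add, hpow, hsecond] at hbound
  have := hM₀ M ((le_max_right _ _).trans hM.le)
  linarith

/-! ### The single-scale grid -/

/-- The point `(i / k, 1 / k)` of the grid `B°_k`. -/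
noncomputable def gridPoint (k i : ℕ) : ℝ × ℝ := ((i : ℝ) / k, 1 / (k : ℝ))

/-- The autocorrelation of `ψ` at lag `j`. -/
noncomputable def autocorr (ψ : ℝ → ℝ) (j : ℕ) : ℝ := (∫ s, ψ (s - j) * ψ s) / ∫ s, ψ s ^ 2

lemma gridPoint_mem_indexSet {k i : ℕ} (hi : i < k) : gridPoint k i ∈ indexSet := by
  have hk : (0 : ℝ) < k := by exact_mod_cast (by omega : 0 < k)
  have hk1 : (1 : ℝ) ≤ k := by exact_mod_cast (by omega : 1 ≤ k)
  have hik : (i : ℝ) ≤ k := by exact_mod_cast hi.le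
  exact ⟨⟨by simp only [gridPoint]; positivity, (div_le_one hk).2 hik⟩,
    by simp only [gridPoint]; positivity, (div_le_one hk).2 hk1⟩

lemma memLp_kernel {ψ : ℝ → ℝ} (hψ : MemLp ψ 2 volume) (t : ℝ) {h : ℝ} (hh : h ≠ 0) :
    MemLp (kernel ψ (t, h)) 2 volume := by
  have h1 : MemLp (fun x => ψ (x * h⁻¹)) 2 volume := by
    have hm := (Homeomorph.mulRight₀ h⁻¹ (inv_ne_zero hh)).measurableEmbedding.memLp_map_measure_iff
      (μ := volume) (g := ψ) (p := 2)
    refine hm.1 ?_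
    change MemLp ψ 2 (Measure.map (fun x => x * h⁻¹) volume)
    rw [Real.map_volume_mul_right (inv_ne_zero hh)]
    exact hψ.smul_measure (by simp)
  exact h1.comp_measurePreserving (measurePreserving_sub_right volume t)

lemma integral_kernel_mul_kernel (ψ : ℝ → ℝ) (t t' : ℝ) {h : ℝ} (hh : 0 < h) :
    ∫ s, kernel ψ (t, h) s * kernel ψ (t', h) s =
      h * ∫ s, ψ (s - (t' - t) / h) * ψ s := by
  have e : ∀ s, kernel ψ (t, h) s * kernel ψ (t', h) s =
      (fun y => ψ (y / h - (t' - t) / h) * ψ (y / h)) (s - t) := by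
    intro s
    simp only [kernel]
    rw [mul_comm]
    congr 2
    rw [← sub_div]
    ring_nf
  simp_rw [e]
  rw [integral_sub_right_eq_self (fun y => ψ (y / h - (t' - t) / h) * ψ (y / h)) t,
    Measure.integral_comp_div (fun y => ψ (y - (t' - t) / h) * ψ y) h, abs_of_pos hh, smul_eq_mul]

lemma integral_kernel_sq (ψ : ℝ → ℝ) (t : ℝ) {h : ℝ} (hh : 0 < h) :
    ∫ s, kernel ψ (t, h) s ^ 2 = h * ∫ s, ψ s ^ 2 := by
  have := integral_kernel_mul_kernel ψ t t hh
  simpa [← sq] using this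

lemma integral_sq_pos {ψ : ℝ → ℝ} (hψ : MemLp ψ 2 volume) (hψ0 : ¬ ψ =ᵐ[volume] 0) :
    0 < ∫ s, ψ s ^ 2 := by
  refine lt_of_le_of_ne (integral_nonneg fun s => sq_nonneg _) fun h => hψ0 ?_
  have := (integral_eq_zero_iff_of_nonneg (fun s => sq_nonneg (ψ s)) hψ.integrable_sq).1 h.symm
  filter_upwards [this] with s hs
  simpa using hs

lemma lpNorm_kernel {ψ : ℝ → ℝ} (hψ : MemLp ψ 2 volume) (t : ℝ) {h : ℝ} (hh : 0 < h) :
    lpNorm (kernel ψ (t, h)) 2 volume = √(h * ∫ s, ψ s ^ 2) := by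
  have hm := memLp_kernel hψ t hh.ne'
  rw [← toReal_eLpNorm hm.1, eLpNorm_two_eq_ofReal_sqrt hm,
    ENNReal.toReal_ofReal (Real.sqrt_nonneg _), integral_kernel_sq ψ t hh]

lemma integral_kernel_gridPoint (ψ : ℝ → ℝ) (hψ : 0 < ∫ s, ψ s ^ 2) {k i j : ℕ} (hk : 0 < k)
    (hij : i ≤ j) :
    ∫ s, kernel ψ (gridPoint k i) s * kernel ψ (gridPoint k j) s =
      autocorr ψ (j - i) * √(1 / (k : ℝ) * ∫ s, ψ s ^ 2) ^ 2 := by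
  have hk' : (0 : ℝ) < k := by exact_mod_cast hk
  rw [gridPoint, gridPoint, integral_kernel_mul_kernel ψ _ _ (by positivity),
    Real.sq_sqrt (by positivity), autocorr, Nat.cast_sub hij]
  have e : ((j : ℝ) / k - i / k) / (1 / (k : ℝ)) = (j : ℝ) - i := by field_simp
  rw [e]
  field_simp

/-- A calibrated statistic exceeds `c` exactly when the standardized Wiener integral exceeds the
threshold. -/
lemma le_localStat_iff {ν : ℝ} {ψ : ℝ → ℝ} {k i : ℕ} {c x : ℝ}
    (hL : 1 < Real.log (ν * k)) :
    c ≤ localStat ν ψ (gridPoint k i) x ↔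
      threshold c (Real.log (ν * k)) ≤ |x| / lpNorm (kernel ψ (gridPoint k i)) 2 volume := by
  have hloglog : 0 < Real.log (Real.log (ν * k)) := Real.log_pos hL
  have hs : 0 < √(1 / 2 * Real.log (ν * k)) := Real.sqrt_pos.2 (by linarith)
  have e : ν / (gridPoint k i).2 = ν * k := by simp [gridPoint]
  rw [localStat, weight, e, threshold, ← le_sub_iff_add_le',
    ← div_le_iff₀' (div_pos hs hloglog), div_div_eq_mul_div, mul_div_assoc]

lemma isWienerIntegral_gridPoint (hW : IsTwoSidedBrownian W P) {ψ : ℝ → ℝ}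
    (hψ : MemLp ψ 2 volume) {X : ℝ × ℝ → Ω → ℝ}
    (hX : ∀ p ∈ indexSet, X p =ᵐ[P] wienerIntegral P W (kernel ψ p)) {k i : ℕ} (hi : i < k) :
    IsWienerIntegral P W (kernel ψ (gridPoint k i)) (X (gridPoint k i)) := by
  have hk : (k : ℝ) ≠ 0 := by exact_mod_cast (by omega : k ≠ 0)
  have hm : MemLp (kernel ψ (gridPoint k i)) 2 volume := memLp_kernel hψ _ (by simp [hk])
  exact (isWienerIntegral_wienerIntegral hW hm).congr (hX _ (gridPoint_mem_indexSet hi)).symm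

lemma hasLaw_standardized (hW : IsTwoSidedBrownian W P) {ψ : ℝ → ℝ}
    (hψ : MemLp ψ 2 volume) (hψ0 : ¬ ψ =ᵐ[volume] 0) {X : ℝ × ℝ → Ω → ℝ}
    (hX : ∀ p ∈ indexSet, X p =ᵐ[P] wienerIntegral P W (kernel ψ p)) {k i : ℕ} (hi : i < k) :
    HasLaw (fun ω => X (gridPoint k i) ω / lpNorm (kernel ψ (gridPoint k i)) 2 volume)
      (gaussianReal 0 1) P := by
  have hk : (0 : ℝ) < k := by exact_mod_cast (by omega : 0 < k)
  have hI := integral_sq_pos hψ hψ0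
  have hm : MemLp (kernel ψ (gridPoint k i)) 2 volume := memLp_kernel hψ _ (by simp [hk.ne'])
  have h := (isWienerIntegral_gridPoint hW hψ hX hi).hasLaw hW hm
  have h2 := gaussianReal_div_const h (lpNorm (kernel ψ (gridPoint k i)) 2 volume)
  rw [gridPoint] at h2 ⊢
  rw [integral_kernel_sq ψ _ (by positivity), lpNorm_kernel hψ _ (by positivity)] at h2
  rw [lpNorm_kernel hψ _ (by positivity)]
  convert h2 using 2
  · simp
  · ext
    have : 0 < 1 / (k : ℝ) * ∫ s, ψ s ^ 2 := by positivity
    rw [NNReal.coe_div, Real.coe_toNNReal _ this.le]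
    simp only [NNReal.coe_one, NNReal.coe_mk]
    rw [Real.sq_sqrt this.le, div_self this.ne']

lemma tendsto_log_const_mul {ν : ℝ} (hν : 0 < ν) :
    Tendsto (fun k : ℕ => Real.log (ν * k)) atTop atTop :=
  Real.tendsto_log_atTop.comp (tendsto_natCast_atTop_atTop.const_mul_atTop hν)

lemma le_two_mul_mul_div {k m : ℕ} (hm : 0 < m) (h : 1 ≤ k / m) :
    (k : ℝ) ≤ 2 * m * ((k / m : ℕ) : ℝ) := by
  have h1 := Nat.div_add_mod k m
  have h2 := Nat.mod_lt k hm
  have h3 : m * 1 ≤ m * (k / m) := Nat.mul_le_mul_left m h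
  have h4 : k ≤ 2 * (m * (k / m)) := by omega
  rw [mul_assoc]
  exact_mod_cast h4

/-! ### The two one-sided bounds over the grid -/

/-- Union bound: no statistic over the grid exceeds `-1/4 + ε`, with probability tending to one. -/
lemma tendsto_measure_exists_ge (hW : IsTwoSidedBrownian W P) {ν : ℝ} (hν : 0 < ν) {ψ : ℝ → ℝ}
    (hψ : MemLp ψ 2 volume) (hψ0 : ¬ ψ =ᵐ[volume] 0) {X : ℝ × ℝ → Ω → ℝ}
    (hX : ∀ p ∈ indexSet, X p =ᵐ[P] wienerIntegral P W (kernel ψ p)) {ε : ℝ} (hε : 0 < ε) :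
    Tendsto (fun k : ℕ => P {ω | ∃ i < k,
      -1 / 4 + ε ≤ localStat ν ψ (gridPoint k i) (X (gridPoint k i) ω)}) atTop (𝓝 0) := by
  have hlogt := tendsto_log_const_mul hν
  have hlim := ENNReal.tendsto_ofReal
    (((tendsto_exp_mul_tail hε).comp hlogt).const_mul (1 / ν))
  rw [mul_zero, ENNReal.ofReal_zero] at hlim
  refine tendsto_of_tendsto_of_tendsto_of_le_of_le' tendsto_const_nhds hlim
    (Eventually.of_forall fun _ => zero_le) ?_
  filter_upwards [hlogt.eventually_gt_atTop 1,
    hlogt.eventually (eventually_sqrt_le_threshold (-1 / 4 + ε)), eventually_gt_atTop 0]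
    with k hL hu hk
  have hk' : (0 : ℝ) < k := by exact_mod_cast hk
  have hupos : 0 < threshold (-1 / 4 + ε) (Real.log (ν * k)) :=
    (Real.sqrt_pos.2 (by linarith)).trans_le hu
  simp only [Function.comp_apply]
  set u := threshold (-1 / 4 + ε) (Real.log (ν * k)) with hu_def
  have hsub : {ω | ∃ i < k, -1 / 4 + ε ≤ localStat ν ψ (gridPoint k i) (X (gridPoint k i) ω)} ⊆
      ⋃ i ∈ Finset.range k, {ω | X (gridPoint k i) ω /
        lpNorm (kernel ψ (gridPoint k i)) 2 volume ∈ {x : ℝ | u ≤ |x|}} := by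
    rintro ω ⟨i, hi, h⟩
    rw [le_localStat_iff hL] at h
    simp only [Set.mem_iUnion, Finset.mem_range]
    refine ⟨i, hi, ?_⟩
    simpa [abs_div, abs_of_nonneg (lpNorm_nonneg (f := kernel ψ (gridPoint k i)))] using h
  refine (measure_mono hsub).trans ((measure_biUnion_finset_le _ _).trans ?_)
  have hone : ∀ i ∈ Finset.range k, P {ω | X (gridPoint k i) ω /
        lpNorm (kernel ψ (gridPoint k i)) 2 volume ∈ {x : ℝ | u ≤ |x|}} ≤
      ENNReal.ofReal (Real.exp (-u ^ 2 / 2) / u) := by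
    intro i hi
    have hlaw := hasLaw_standardized hW hψ hψ0 hX (Finset.mem_range.1 hi)
    refine le_trans (le_of_eq ?_) (gaussianReal_abs_ge_le hupos)
    have hms : MeasurableSet {x : ℝ | u ≤ |x|} := measurableSet_le (by fun_prop) (by fun_prop)
    rw [← hlaw.map_eq, Measure.map_apply_of_aemeasurable hlaw.aemeasurable hms]
    rfl
  refine (Finset.sum_le_sum hone).trans (le_of_eq ?_)
  rw [Finset.sum_const, Finset.card_range, nsmul_eq_mul, ← ENNReal.ofReal_natCast,
    ← ENNReal.ofReal_mul hk'.le, Real.exp_log (by positivity)]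
  congr 1
  field_simp

/-- Second moment bound: some statistic over the grid reaches `-1/4 - ε`, with probability tending
to one. The argument keeps only the grid points whose index is a multiple of some fixed `m`, chosen
such that all autocorrelations at nonzero multiples of `m` are small; this costs a constant factor
in the expected number of exceedances, which tends to infinity nevertheless. -/
lemma tendsto_measure_forall_lt (hW : IsTwoSidedBrownian W P) {ν : ℝ} (hν : 0 < ν) {ψ : ℝ → ℝ}
    (hψ : MemLp ψ 2 volume) (hψ0 : ¬ ψ =ᵐ[volume] 0)
    (hdecay : Tendsto (fun j : ℕ => Real.log j * |∫ s, ψ (s - j) * ψ s|) atTop (𝓝 0))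
    {X : ℝ × ℝ → Ω → ℝ}
    (hX : ∀ p ∈ indexSet, X p =ᵐ[P] wienerIntegral P W (kernel ψ p)) {ε : ℝ} (hε : 0 < ε) :
    Tendsto (fun k : ℕ => P {ω | ∀ i < k,
      localStat ν ψ (gridPoint k i) (X (gridPoint k i) ω) < -1 / 4 - ε}) atTop (𝓝 0) := by
  have := hW.isProbabilityMeasure
  have hI := integral_sq_pos hψ hψ0
  have hlogt := tendsto_log_const_mul hν
  have hcorr : Tendsto (fun j : ℕ => Real.log j * |autocorr ψ j|) atTop (𝓝 0) := by
    have := hdecay.div_const (∫ s, ψ s ^ 2)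
    rw [zero_div] at this
    refine this.congr fun j => ?_
    rw [autocorr, abs_div, abs_of_pos hI, mul_div_assoc]
  obtain ⟨m, hm0, hm⟩ : ∃ m : ℕ, 0 < m ∧ ∀ j, m ≤ j → |autocorr ψ j| ≤ 1 / 18 := by
    have h1 : ∀ᶠ j : ℕ in atTop, |autocorr ψ j| ≤ 1 / 18 := by
      filter_upwards [hcorr.eventually_lt_const (by norm_num : (0 : ℝ) < 1 / 18),
        (Real.tendsto_log_atTop.comp tendsto_natCast_atTop_atTop).eventually_ge_atTop 1]
        with j h1 h2
      simp only [Function.comp_apply] at h2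
      nlinarith [abs_nonneg (autocorr ψ j)]
    obtain ⟨m, hm⟩ := eventually_atTop.1 h1
    exact ⟨max m 1, by simp, fun j hj => hm j (le_trans (le_max_left _ _) hj)⟩
  let b : ℕ → ℝ := fun j => |autocorr ψ (m * j)|
  have hb0 : ∀ j, 0 ≤ b j := fun j => abs_nonneg _
  have hb : ∀ j, 1 ≤ j → b j ≤ 1 / 18 := fun j hj => hm _ (Nat.le_mul_of_pos_right m hj)
  have hblog : Tendsto (fun j : ℕ => Real.log j * b j) atTop (𝓝 0) := by
    have hmt : Tendsto (fun j : ℕ => m * j) atTop atTop :=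
      tendsto_id.const_mul_atTop' hm0
    refine tendsto_of_tendsto_of_tendsto_of_le_of_le' tendsto_const_nhds (hcorr.comp hmt)
      (Eventually.of_forall fun j => mul_nonneg (Real.log_natCast_nonneg j) (hb0 j)) ?_
    filter_upwards [eventually_gt_atTop 0] with j hj
    refine mul_le_mul_of_nonneg_right (Real.log_le_log (by exact_mod_cast hj) ?_) (hb0 j)
    exact_mod_cast Nat.le_mul_of_pos_left j hm0
  have hMt : Tendsto (fun k : ℕ => k / m) atTop atTop := Nat.tendsto_div_const_atTop hm0.ne'
  have havg := (tendsto_average_exp_correlation hb0 hb hblog).comp hMt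
  have hmean := (((tendsto_exp_mul_density hε).comp hlogt).const_mul_atTop
    (by positivity : 0 < 1 / (2 * m * ν))).inv_tendsto_atTop
  have hlim := ENNReal.tendsto_ofReal (hmean.add (havg.const_mul 2))
  rw [mul_zero, add_zero, ENNReal.ofReal_zero] at hlim
  refine tendsto_of_tendsto_of_tendsto_of_le_of_le' tendsto_const_nhds hlim
    (Eventually.of_forall fun _ => zero_le) ?_
  -- the number `k / m` of retained grid points is of order `k`, so that eventually
  -- `v² + 1 ≤ 3 L ≤ (9 / 2) log (k / m)`
  have hlogM : ∀ᶠ k : ℕ in atTop, Real.log (ν * k) ≤ 3 / 2 * Real.log ((k / m : ℕ) : ℝ) := by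
    have h1 := (Real.tendsto_log_atTop.comp
      (tendsto_natCast_atTop_atTop.comp hMt)).eventually_ge_atTop (2 * Real.log (2 * m * ν))
    filter_upwards [h1, hMt.eventually_ge_atTop 1, eventually_gt_atTop 0] with k h1 h2 hk
    simp only [Function.comp_apply] at h1
    have hk' : (0 : ℝ) < k := by exact_mod_cast hk
    have hM' : (0 : ℝ) < ((k / m : ℕ) : ℝ) := by exact_mod_cast h2
    have hm' : (0 : ℝ) < m := by exact_mod_cast hm0
    have h3 := le_two_mul_mul_div hm0 h2
    have h4 : ν * k ≤ 2 * m * ν * ((k / m : ℕ) : ℝ) := by nlinarith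
    have h5 := Real.log_le_log (by positivity) h4
    rw [Real.log_mul (by positivity) hM'.ne'] at h5
    linarith
  filter_upwards [hlogt.eventually_ge_atTop 4, hlogM,
    hlogt.eventually (eventually_sqrt_le_threshold (-1 / 4 - ε)), eventually_gt_atTop 0,
    hMt.eventually_ge_atTop 1] with k hL hLM hu hk hM
  have hk' : (0 : ℝ) < k := by exact_mod_cast hk
  have hm' : (0 : ℝ) < m := by exact_mod_cast hm0
  have hM' : (0 : ℝ) < ((k / m : ℕ) : ℝ) := by exact_mod_cast hM
  simp only [Function.comp_apply, Pi.inv_apply]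
  set L := Real.log (ν * k) with hL_def
  set M := k / m with hM_def
  have hLpos : 0 < L := by linarith
  have hu1 : 1 ≤ threshold (-1 / 4 - ε) L :=
    (Real.one_le_sqrt.2 (by linarith)).trans hu
  have hu2 : threshold (-1 / 4 - ε) L ≤ √(2 * L) := threshold_le (by linarith) (by linarith)
  set u := threshold (-1 / 4 - ε) L with hu_def
  have hupos : 0 < u := by linarith
  set v := u + 1 / u with hv_def
  have hv : v ^ 2 + 1 ≤ 3 * L := by
    have h2 : 1 / u ≤ 1 := (div_le_one hupos).2 hu1
    have h3 : v ^ 2 = u ^ 2 + 2 + (1 / u) ^ 2 := by rw [hv_def]; field_simp; ring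
    have h4 : 0 ≤ 1 / u := by positivity
    have h5 : u ^ 2 ≤ 2 * L := by
      calc u ^ 2 ≤ √(2 * L) ^ 2 := by gcongr
        _ = 2 * L := Real.sq_sqrt (by positivity)
    nlinarith
  set p := (gaussianReal 0 1).real (Set.Icc u v) with hp_def
  have hdens := le_gaussianReal_Icc hupos
  rw [← hv_def, ← hp_def] at hdens
  have hppos : 0 < p := lt_of_lt_of_le (by positivity) hdens
  have hlt : ∀ i < M, m * i < k := fun i hi => by
    calc m * i < m * M := Nat.mul_lt_mul_of_pos_left hi hm0
      _ ≤ k := Nat.mul_div_le k m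
  let Z : ℕ → Ω → ℝ := fun i ω =>
    X (gridPoint k (m * i)) ω / lpNorm (kernel ψ (gridPoint k (m * i))) 2 volume
  have hlaw : ∀ i < M, HasLaw (Z i) (gaussianReal 0 1) P := fun i hi =>
    hasLaw_standardized hW hψ hψ0 hX (hlt i hi)
  have hsm := measure_forall_notMem_le (P := P) (A := fun i => Z i ⁻¹' Set.Icc u v) (M := M)
    (p := p) (c := fun j => Real.exp (9 / 2 * Real.log M * b j)) hM hppos
    (fun i hi => (hlaw i hi).aemeasurable.nullMeasurableSet_preimage measurableSet_Icc)
    (fun i hi => by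
      rw [hp_def, ← (hlaw i hi).map_eq, Measure.real, Measure.real,
        Measure.map_apply_of_aemeasurable (hlaw i hi).aemeasurable measurableSet_Icc])
    (fun j => Real.one_le_exp (mul_nonneg (mul_nonneg (by norm_num)
      (Real.log_natCast_nonneg M)) (hb0 j)))
    (fun i j hij hj => by
      have hi : i < M := hij.trans hj
      have hmk : ∀ i, MemLp (kernel ψ (gridPoint k i)) 2 volume := fun i =>
        memLp_kernel hψ _ (by simp [hk.ne'])
      have hnorm : ∀ i, lpNorm (kernel ψ (gridPoint k i)) 2 volume =
          √(1 / (k : ℝ) * ∫ s, ψ s ^ 2) := fun i => lpNorm_kernel hψ _ (by positivity)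
      have hsq : ∀ i, ∫ s, kernel ψ (gridPoint k i) s ^ 2 =
          √(1 / (k : ℝ) * ∫ s, ψ s ^ 2) ^ 2 := fun i => by
        rw [Real.sq_sqrt (by positivity)]
        exact integral_kernel_sq ψ _ (by positivity)
      have hlag : m * j - m * i = m * (j - i) := (Nat.mul_sub m j i).symm
      have hbd := hb (j - i) (by omega)
      have hpair := (isWienerIntegral_gridPoint hW hψ hX (hlt i hi)).measure_pair_Icc_le hW
        (hmk _) (hmk _) (isWienerIntegral_gridPoint hW hψ hX (hlt j hj)) (u := u) (v := v)
        (Real.sqrt_pos.2 (by positivity)) (hsq _) (hsq _)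
        (integral_kernel_gridPoint ψ hI hk (Nat.mul_le_mul_left m hij.le))
        (by rw [hlag]; exact hbd.trans (by norm_num)) hupos.le
      have hset : Z i ⁻¹' Set.Icc u v ∩ Z j ⁻¹' Set.Icc u v =
          {ω | X (gridPoint k (m * i)) ω / √(1 / (k : ℝ) * ∫ s, ψ s ^ 2) ∈ Set.Icc u v ∧
            X (gridPoint k (m * j)) ω / √(1 / (k : ℝ) * ∫ s, ψ s ^ 2) ∈ Set.Icc u v} := by
        ext ω
        simp only [Z, hnorm]
        rfl
      have h1 := ENNReal.toReal_mono (by finiteness) hpair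
      rw [ENNReal.toReal_mul, ENNReal.toReal_ofReal (Real.exp_pos _).le, ENNReal.toReal_pow,
        ← hset, hlag] at h1
      change P.real _ ≤ _ * p ^ 2 at h1
      refine h1.trans ?_
      rw [mul_comm]
      refine mul_le_mul_of_nonneg_left (Real.exp_le_exp.2 ?_) (sq_nonneg p)
      change b (j - i) * (v ^ 2 + 1) ≤ 9 / 2 * Real.log M * b (j - i)
      rw [mul_comm]
      exact mul_le_mul_of_nonneg_right (by linarith) (hb0 _))
  have hsub : {ω | ∀ i < k, localStat ν ψ (gridPoint k i) (X (gridPoint k i) ω) < -1 / 4 - ε} ⊆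
      {ω | ∀ i < M, ω ∉ Z i ⁻¹' Set.Icc u v} := by
    intro ω hω i hi hmem
    refine (hω _ (hlt i hi)).not_ge ((le_localStat_iff (by linarith)).2 ?_)
    have h1 : u ≤ Z i ω := hmem.1
    have h2 : Z i ω ≤ |X (gridPoint k (m * i)) ω| /
        lpNorm (kernel ψ (gridPoint k (m * i))) 2 volume :=
      div_le_div_of_nonneg_right (le_abs_self _) lpNorm_nonneg
    exact h1.trans h2
  refine (measure_mono hsub).trans ?_
  rw [← ofReal_measureReal]
  refine ENNReal.ofReal_le_ofReal (hsm.trans (add_le_add_left ?_ _))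
  rw [one_div]
  refine inv_anti₀ (by positivity) ?_
  have h3 : (k : ℝ) ≤ 2 * m * (M : ℝ) := le_two_mul_mul_div hm0 hM
  rw [hL_def, Real.exp_log (by positivity)]
  calc 1 / (2 * m * ν) * (ν * k * ((√(2 * Real.pi))⁻¹ * Real.exp (-v ^ 2 / 2) / u))
      ≤ 1 / (2 * m * ν) * (ν * (2 * m * M) * p) := by gcongr
    _ = M * p := by field_simp

/-! ### Suprema over the grid -/

lemma finite_grid (K : ℕ) : (grid K).Finite := by
  refine ((Set.finite_lt_nat K).image (gridPoint K)).subset ?_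
  rintro p ⟨i, hi, rfl⟩
  exact ⟨i, hi, rfl⟩

lemma exists_le_of_le_iSup_grid {K : ℕ} (hK : 0 < K) {f : ℝ × ℝ → ℝ} {c : ℝ}
    (h : c ≤ ⨆ p : grid K, f p) : ∃ i < K, c ≤ f (gridPoint K i) := by
  have : Finite (grid K) := finite_grid K
  have : Nonempty (grid K) := ⟨⟨gridPoint K 0, 0, hK, rfl⟩⟩
  obtain ⟨⟨p, i, hi, rfl⟩, hp⟩ := exists_eq_ciSup_of_finite (f := fun p : grid K => f p)
  exact ⟨i, hi, hp ▸ h⟩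

lemma le_iSup_grid {K i : ℕ} (hi : i < K) (f : ℝ × ℝ → ℝ) :
    f (gridPoint K i) ≤ ⨆ p : grid K, f p := by
  have : Finite (grid K) := finite_grid K
  exact le_ciSup (f := fun p : grid K => f p) (Set.finite_range _).bddAbove
    ⟨gridPoint K i, i, hi, rfl⟩

end Multiscale

/-- `X (t, h)` is any version of `∫ ψ_{t,h} dW`. The first part is the limit over the grids (finite
suprema); the second is the asymptotic lower bound over all index sets containing the grids, with
suprema in the extended reals, so that no boundedness or measurability is presupposed. -/
theorem mainTheorem6 {Ω : Type*} [MeasurableSpace Ω] (P : Measure Ω) [IsProbabilityMeasure P]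
    (W : ℝ → Ω → ℝ) (hW : Multiscale.IsTwoSidedBrownian W P)
    (ν : ℝ) (hν : Real.exp 1 < ν)
    (ψ : ℝ → ℝ) (hψ : MemLp ψ 2 volume) (hψ0 : ¬ ψ =ᵐ[volume] 0)
    (hdecay : Tendsto (fun j : ℕ => Real.log j * |∫ s, ψ (s - j) * ψ s|) atTop (𝓝 0))
    (K : ℕ → ℕ) (hK : Tendsto K atTop atTop)
    (X : ℝ × ℝ → Ω → ℝ)
    (hX : ∀ p ∈ Multiscale.indexSet,
      X p =ᵐ[P] Multiscale.wienerIntegral P W (Multiscale.kernel ψ p)) :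
    TendstoInMeasure P
      (fun n ω => ⨆ p : Multiscale.grid (K n), Multiscale.localStat ν ψ p (X p ω))
      atTop (fun _ => -1 / 4) ∧
    ∀ B : ℕ → Set (ℝ × ℝ),
      (∀ n, B n ⊆ Multiscale.indexSet) → (∀ n, Multiscale.grid (K n) ⊆ B n) →
      ∀ ε : ℝ, 0 < ε →
        Tendsto
          (fun n => P {ω | (⨆ p ∈ B n, (Multiscale.localStat ν ψ p (X p ω) : EReal))
            ≤ ((-1 / 4 - ε : ℝ) : EReal)})
          atTop (𝓝 0) := by
  have hν0 : 0 < ν := (Real.exp_pos 1).trans hν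
  constructor
  · rw [tendstoInMeasure_iff_dist]
    intro ε hε
    have hup := (Multiscale.tendsto_measure_exists_ge hW hν0 hψ hψ0 hX hε).comp hK
    have hlow := (Multiscale.tendsto_measure_forall_lt hW hν0 hψ hψ0 hdecay hX
      (half_pos hε)).comp hK
    have hsum := hup.add hlow
    rw [add_zero] at hsum
    refine tendsto_of_tendsto_of_tendsto_of_le_of_le' tendsto_const_nhds hsum
      (Eventually.of_forall fun _ => zero_le) ?_
    filter_upwards [hK.eventually_gt_atTop 0] with n hn
    refine le_trans (measure_mono ?_) (measure_union_le _ _)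
    intro ω hω
    have hω' : ε ≤ |(⨆ p : Multiscale.grid (K n), Multiscale.localStat ν ψ p (X p ω)) -
      -1 / 4| := hω
    rcases le_abs.1 hω' with h | h
    · exact Or.inl (Multiscale.exists_le_of_le_iSup_grid hn
        (f := fun p => Multiscale.localStat ν ψ p (X p ω)) (by linarith))
    · refine Or.inr fun i hi => ?_
      have := Multiscale.le_iSup_grid hi (fun p => Multiscale.localStat ν ψ p (X p ω))
      linarith
  · intro B _ hgrid ε hε
    have hlow := (Multiscale.tendsto_measure_forall_lt hW hν0 hψ hψ0 hdecay hX
      (half_pos hε)).comp hK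
    refine tendsto_of_tendsto_of_tendsto_of_le_of_le tendsto_const_nhds hlow
      (fun _ => zero_le) fun n => measure_mono fun ω hω i hi => ?_
    have h1 : (Multiscale.localStat ν ψ (Multiscale.gridPoint (K n) i)
        (X (Multiscale.gridPoint (K n) i) ω) : EReal) ≤ ((-1 / 4 - ε : ℝ) : EReal) :=
      (le_iSup₂ (f := fun p (_ : p ∈ B n) => (Multiscale.localStat ν ψ p (X p ω) : EReal)) _
        (hgrid n ⟨i, hi, rfl⟩)).trans hω
    have h2 := EReal.coe_le_coe_iff.1 h1
    linarith
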